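/- Let $M$ be a complex manifold of complex dimension $n$, with complex structure $J$, and let $g$ be an indefinite Hermitian metric on $M$ of index $2s$, $0<s<n$ (a $C^\infty$ semi-Riemannian metric of index $2s$ with $g(JX,JY)=g(X,Y)$), with Levi-Civita connection $\nabla$. Assume that $g$ is locally conformal Kähler: every point of $M$ has an open neighbourhood $U$ with a $C^\infty$ function $f:U\to\mathbb R$ such that $e^{-f}g$ is an indefinite Kähler metric on $U$ (i.e. $J$ is parallel for its Levi-Civita connection). Let $\omega$ be the Lee form (the global $1$-form which equals $df$ on each such $U$), $B$ the Lee field ($g(X,B)=\omega(X)$ for all $X$), $A=-JB$ the anti-Lee field and $Z=B+iA$. Assume that $\nabla\omega=0$ and that $B$ is lightlike, i.e. $B$ vanishes nowhere and $g(B,B)=0$. Let $\mathcal F$ be the foliation of $M$ given by $\omega=0$ (the first canonical foliation), and let $\mathcal F_0$ be the foliation with tangent bundle $P=\mathbb RA\oplus\mathbb RB$ (the second canonical foliation). Put $T_{1,0}(\mathcal F)=T^{1,0}(M)\cap[T(\mathcal F)\otimes\mathbb C]$ and $H(\mathcal F)=\mathrm{Re}\{T_{1,0}(\mathcal F)\oplus\overline{T_{1,0}(\mathcal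 F)}\}$; their restrictions to a leaf $L$ of $\mathcal F$ are the CR structure and the Levi distribution $H(L)$ of $L$. The Levi form of the leaves is $\mathcal L(V,\overline W)=i\,\pi[V,\overline W]$ for $V,W\in T_{1,0}(\mathcal F)$, where $\pi:T(\mathcal F)\to T(\mathcal F)/H(\mathcal F)$ is the projection. A leaf is Levi-flat if its Levi form vanishes identically; its Levi foliation is then the foliation of $L$ with tangent bundle $H(L)$. A holomorphic foliation of $M$ is an involutive holomorphic subbundle of the holomorphic tangent bundle (identified with $(T(M),J)$); it extends the Levi foliation of $L$ if its tangent bundle coincides with $H(L)$ along $L$. Then: (1) The Levi form of each leaf of $\mathcal F$ is degenerate at every point: $Z$ is a nowhere vanishing section of $T_{1,0}(\mathcal F)$ with $\mathcal L(Z,\overline W)=0$ for all $W\in T_{1,0}(\mathcal F)$; in particular $\mathcal L(Z,\overline Z)=0$. (2) $P$ is involutive and $\mathcal F_0$ is a subfoliation of $\mathcal F$: $P\subseteq T(\mathcal F)$, and each leaf of $\mathcal F_0$ is contained in a leaf of $\mathcal F$. (3) If $n=2$, then each leaf of $\mathcal F$ is Levi-flat, and $\mathcal F_0$ is a holomorphic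 foliation of $M$ which extends the Levi foliation of every leaf of $\mathcal F$. It is the only holomorphic foliation of $M$ that extends the Levi foliations of all leaves of $\mathcal F$; and if $M$ is connected, then for each single leaf $L$ of $\mathcal F$ it is the only holomorphic foliation of $M$ that extends the Levi foliation of $L$. -/

import Mathlib

open Set
open scoped Manifold ContDiff Topology

/-- The real manifold underlying a complex manifold. -/
instance IndefLCK.realManifold {E : Type*} [NormedAddCommGroup E] [NormedSpace ℂ E]
    {M : Type*} [TopologicalSpace M] [ChartedSpace E M] [IsManifold 𝓘(ℂ, E) ω M] :
    IsManifold 𝓘(ℝ, E) ω M := by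
  apply isManifold_of_contDiffOn
  intro e e' he he'
  have h := (contDiffGroupoid ω 𝓘(ℂ, E)).compatible he he'
  rw [contDiffGroupoid, mem_groupoid_of_pregroupoid] at h
  exact ContDiffOn.restrict_scalars ℝ h.1

namespace IndefLCK

noncomputable section

section Basic

variable (E : Type*) [NormedAddCommGroup E] [NormedSpace ℂ E]
  {M : Type*} [TopologicalSpace M] [ChartedSpace E M]

/-- The real tangent space `T_x(M)` of a complex manifold modelled on `E`. -/
abbrev RT (x : M) : Type _ := TangentSpace 𝓘(ℝ, E) x

variable (M)

/-- Real vector fields (with no regularity). -/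
abbrev VField : Type _ := ∀ x : M, RT E x

/-- Real `1`-forms (with no regularity). -/
abbrev Form1 : Type _ := ∀ x : M, RT E x →L[ℝ] ℝ

/-- Fields of real bilinear forms on the tangent spaces (with no regularity). -/
abbrev BilinField : Type _ := ∀ x : M, RT E x →L[ℝ] RT E x →L[ℝ] ℝ

/-- Sections of the complexified tangent bundle `T(M) ⊗ ℂ` (with no regularity): the pair
`(a, b)` stands for `a + i b`. -/
abbrev CxField : Type _ := ∀ x : M, RT E x × RT E x

/-- Fields of real subspaces of the tangent spaces (with no regularity). -/
abbrev Distribution : Type _ := ∀ x : M, Submodule ℝ (RT E x)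

end Basic

variable {E : Type*} [NormedAddCommGroup E] [NormedSpace ℂ E]
  {M : Type*} [TopologicalSpace M] [ChartedSpace E M]

/-- The complex structure `J` of the complex manifold: multiplication by `i` in a holomorphic
chart (`TangentSpace` at `x` is the model space `E`, read in the preferred chart at `x`). -/
def cxJ (x : M) : RT E x →L[ℝ] RT E x :=
  (Complex.I • ContinuousLinearMap.id ℝ E : E →L[ℝ] E)

/-! ### Smoothness -/

section Smooth

variable [IsManifold 𝓘(ℂ, E) ω M]

/-- The vector field `X` is differentiable at `x`. -/
def DiffAt (X : VField E M) (x : M) : Prop :=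
  MDifferentiableAt 𝓘(ℝ, E) (𝓘(ℝ, E).prod 𝓘(ℝ, E))
    (fun y => (⟨y, X y⟩ : TangentBundle 𝓘(ℝ, E) M)) x

/-- The vector field `X` is `C^∞` at `x`. -/
def SmoothAt (X : VField E M) (x : M) : Prop :=
  ContMDiffAt 𝓘(ℝ, E) (𝓘(ℝ, E).prod 𝓘(ℝ, E)) ∞
    (fun y => (⟨y, X y⟩ : TangentBundle 𝓘(ℝ, E) M)) x

/-- The field of bilinear forms `g` is `C^∞`. -/
def SmoothBilin (g : BilinField E M) : Prop :=
  ContMDiff 𝓘(ℝ, E) (𝓘(ℝ, E).prod 𝓘(ℝ, E →L[ℝ] E →L[ℝ] ℝ)) ∞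
    (fun y => Bundle.TotalSpace.mk' (E →L[ℝ] E →L[ℝ] ℝ)
      (E := fun y : M => RT E y →L[ℝ] RT E y →L[ℝ] ℝ) y (g y))

end Smooth

/-! ### Indefinite Hermitian metrics -/

/-- The symmetric bilinear form `b` is nondegenerate of index `ν`: the maximal dimension of a
subspace on which it is negative definite is `ν`. -/
def HasIndex {V : Type*} [AddCommGroup V] [Module ℝ V] (b : V → V → ℝ) (ν : ℕ) : Prop :=
  (∃ W : Submodule ℝ V, Module.finrank ℝ W = ν ∧ ∀ w ∈ W, w ≠ 0 → b w w < 0) ∧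
    ∀ W : Submodule ℝ V, (∀ w ∈ W, w ≠ 0 → b w w < 0) → Module.finrank ℝ W ≤ ν

/-- `g` is an indefinite Hermitian metric of index `ν` on the complex manifold `M`: a
semi-Riemannian metric of index `ν` for which `J` is an isometry of each tangent space. -/
structure IsIndefHermitian [IsManifold 𝓘(ℂ, E) ω M] (g : BilinField E M) (ν : ℕ) : Prop where
  smooth : SmoothBilin g
  symm : ∀ (x : M) (v w : RT E x), g x v w = g x w v
  nondegenerate : ∀ (x : M) (v : RT E x), (∀ w : RT E x, g x v w = 0) → v = 0
  index : ∀ x : M, HasIndex (fun v w : RT E x => g x v w) ν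
  hermitian : ∀ (x : M) (v w : RT E x), g x (cxJ x v) (cxJ x w) = g x v w

/-! ### The Levi-Civita connection -/

/-- The derivative at `x` of the function `f` in the direction `v`. -/
def dirDeriv (f : M → ℝ) (x : M) (v : RT E x) : ℝ :=
  (mfderiv 𝓘(ℝ, E) 𝓘(ℝ, ℝ) f x v : ℝ)

/-- The Lie bracket of real vector fields. -/
def bracket (X Y : VField E M) : VField E M := VectorField.mlieBracket 𝓘(ℝ, E) X Y

/-- The right-hand side of the Koszul formula for `2 g(∇_X Y, Z)`. -/
def koszul (g : BilinField E M) (X Y Z : VField E M) (x : M) : ℝ :=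
  dirDeriv (fun y => g y (Y y) (Z y)) x (X x) + dirDeriv (fun y => g y (X y) (Z y)) x (Y x)
    - dirDeriv (fun y => g y (X y) (Y y)) x (Z x)
    + g x (bracket X Y x) (Z x) - g x (bracket X Z x) (Y x) - g x (bracket Y Z x) (X x)

open Classical in
/-- The Levi-Civita derivative `(∇_X Y)_x` of the metric `g`: the vector determined by the Koszul
formula `2 g(∇_X Y, Z) = koszul g X Y Z`. -/
def leviCivita [IsManifold 𝓘(ℂ, E) ω M] (g : BilinField E M) (X Y : VField E M) (x : M) :
    RT E x :=
  if h : ∃ v : RT E x, ∀ Z : VField E M, DiffAt Z x → 2 * g x v (Z x) = koszul g X Y Z x then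
    h.choose
  else 0

/-- `∇ α = 0`, i.e. `(∇_X α) Y = X(α(Y)) - α(∇_X Y) = 0`, with `∇` the Levi-Civita connection
of `g`. -/
def IsParallelForm [IsManifold 𝓘(ℂ, E) ω M] (g : BilinField E M) (α : Form1 E M) : Prop :=
  ∀ (x : M) (X Y : VField E M), SmoothAt X x → SmoothAt Y x →
    dirDeriv (fun y => α y (Y y)) x (X x) = α x (leviCivita g X Y x)

/-- The metric `g` is Kähler on the open set `U`: `∇ J = 0` there. -/
def IsKahlerOn [IsManifold 𝓘(ℂ, E) ω M] (g : BilinField E M) (U : Set M) : Prop :=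
  ∀ x ∈ U, ∀ X Y : VField E M, SmoothAt X x → SmoothAt Y x →
    leviCivita g X (fun y => cxJ y (Y y)) x = cxJ x (leviCivita g X Y x)

/-! ### Locally conformal Kähler metrics, the Lee form, the Lee and anti-Lee fields -/

/-- `U` is an open set and `f : U → ℝ` a `C^∞` function such that `e^{-f} g` is Kähler on `U`. -/
def IsLocalConformalFactor [IsManifold 𝓘(ℂ, E) ω M] (g : BilinField E M) (U : Set M)
    (f : M → ℝ) : Prop :=
  IsOpen U ∧ ContMDiffOn 𝓘(ℝ, E) 𝓘(ℝ, ℝ) ∞ f U ∧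
    IsKahlerOn (fun x => Real.exp (-f x) • g x) U

/-- The metric `g` is locally conformal Kähler. -/
def IsLCK [IsManifold 𝓘(ℂ, E) ω M] (g : BilinField E M) : Prop :=
  ∀ x : M, ∃ (U : Set M) (f : M → ℝ), x ∈ U ∧ IsLocalConformalFactor g U f

open Classical in
/-- The Lee form of a locally conformal Kähler metric `g`: at `x` it is `df_x`, where `e^{-f} g`
is Kähler near `x`. In complex dimension at least `2` two such functions `f` differ by a local
constant, so that the choice does not matter. -/
def leeForm [IsManifold 𝓘(ℂ, E) ω M] (g : BilinField E M) : Form1 E M := fun x =>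
  if h : ∃ (f : M → ℝ) (U : Set M), x ∈ U ∧ IsLocalConformalFactor g U f then
    (mfderiv 𝓘(ℝ, E) 𝓘(ℝ, ℝ) h.choose x : RT E x →L[ℝ] ℝ)
  else 0

open Classical in
/-- The Lee field `B` of `g`, determined by `g(X, B) = leeForm g X` for all `X`. -/
def leeField [IsManifold 𝓘(ℂ, E) ω M] (g : BilinField E M) : VField E M := fun x =>
  if h : ∃ b : RT E x, ∀ v : RT E x, g x v b = leeForm g x v then h.choose else 0

/-- The anti-Lee field `A = -J B`. -/
def antiLeeField [IsManifold 𝓘(ℂ, E) ω M] (g : BilinField E M) : VField E M := fun x =>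
  -cxJ x (leeField g x)

/-- The complex vector field `Z = B + i A`. -/
def leeZ [IsManifold 𝓘(ℂ, E) ω M] (g : BilinField E M) : CxField E M := fun x =>
  (leeField g x, antiLeeField g x)

/-- The vector field `X` is lightlike: it vanishes nowhere and `g(X, X) = 0`. -/
def IsLightlike (g : BilinField E M) (X : VField E M) : Prop :=
  ∀ x : M, X x ≠ 0 ∧ g x (X x) (X x) = 0

/-! ### Foliations

A foliation is given by its tangent bundle, an involutive smooth subbundle of `T(M)`. -/

/-- `D` is (the tangent bundle of) a foliation of `M` with leaves of real dimension `k`: it has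
local `C^∞` frames of `k` vector fields and is involutive. -/
structure IsFoliation [IsManifold 𝓘(ℂ, E) ω M] (D : Distribution E M) (k : ℕ) : Prop where
  frame : ∀ x : M, ∃ U : Set M, IsOpen U ∧ x ∈ U ∧ ∃ X : Fin k → VField E M,
    ∀ y ∈ U, (∀ i, SmoothAt (X i) y) ∧ LinearIndependent ℝ (fun i => X i y) ∧
      Submodule.span ℝ (range fun i => X i y) = D y
  involutive : ∀ (x : M) (X Y : VField E M), SmoothAt X x → SmoothAt Y x →
    (∀ᶠ y in 𝓝 x, X y ∈ D y) → (∀ᶠ y in 𝓝 x, Y y ∈ D y) → bracket X Y x ∈ D x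

/-- There is a smooth curve from `x` to `y` tangent to `D`. -/
def TangentJoined (D : Distribution E M) (x y : M) : Prop :=
  ∃ γ : ℝ → M, ContMDiff 𝓘(ℝ, ℝ) 𝓘(ℝ, E) ∞ γ ∧ γ 0 = x ∧ γ 1 = y ∧
    ∀ t : ℝ, mfderiv 𝓘(ℝ, ℝ) 𝓘(ℝ, E) γ t (1 : ℝ) ∈ D (γ t)

/-- The leaf through `x` of the foliation `D`, i.e. its maximal connected integral manifold through
`x`: the points reached from `x` along finitely many smooth curves tangent to `D`. -/
def leaf (D : Distribution E M) (x : M) : Set M := {y | Relation.EqvGen (TangentJoined D) x y}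

/-- The leaf space of the foliation `D`. -/
def leaves (D : Distribution E M) : Set (Set M) := range (leaf D)

/-- The foliation `D` is a subfoliation of the foliation `D'`. -/
structure IsSubfoliation [IsManifold 𝓘(ℂ, E) ω M] (D D' : Distribution E M) : Prop where
  foliation : ∃ k, IsFoliation D k
  foliation' : ∃ k, IsFoliation D' k
  tangent_le : ∀ x : M, D x ≤ D' x
  leaf_subset : ∀ x : M, leaf D x ⊆ leaf D' x

/-- `D` is a holomorphic foliation of `M` with leaves of complex dimension `k`: it is locally
spanned over `ℂ` by `k` pointwise independent holomorphic vector fields, and is involutive. -/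
structure IsHolomorphicFoliation [IsManifold 𝓘(ℂ, E) ω M] (D : Distribution E M) (k : ℕ) :
    Prop where
  frame : ∀ x : M, ∃ U : Set M, IsOpen U ∧ x ∈ U ∧
    ∃ X : Fin k → ∀ y : M, TangentSpace 𝓘(ℂ, E) y,
      (∀ i, ContMDiffOn 𝓘(ℂ, E) (𝓘(ℂ, E).prod 𝓘(ℂ, E)) ω
        (fun y => (⟨y, X i y⟩ : TangentBundle 𝓘(ℂ, E) M)) U) ∧
      ∀ y ∈ U, LinearIndependent ℂ (fun i => X i y) ∧
        ∀ v : TangentSpace 𝓘(ℂ, E) y,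
          v ∈ Submodule.span ℂ (range fun i => X i y) ↔ (v : RT E y) ∈ D y
  involutive : ∀ (x : M) (X Y : VField E M), SmoothAt X x → SmoothAt Y x →
    (∀ᶠ y in 𝓝 x, X y ∈ D y) → (∀ᶠ y in 𝓝 x, Y y ∈ D y) → bracket X Y x ∈ D x

/-- The first canonical foliation `F`, given by the Pfaff equation `leeForm g = 0`. -/
def firstFoliation [IsManifold 𝓘(ℂ, E) ω M] (g : BilinField E M) : Distribution E M := fun x =>
  LinearMap.ker (leeForm g x).toLinearMap

/-- The second canonical foliation, `x ↦ ℝ A_x + ℝ B_x`. -/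
def secondFoliation [IsManifold 𝓘(ℂ, E) ω M] (g : BilinField E M) : Distribution E M := fun x =>
  Submodule.span ℝ {antiLeeField g x, leeField g x}

/-! ### The CR structure and the Levi form of the leaves of a foliation by real hypersurfaces

In this section `D` is the tangent bundle of such a foliation, so that `D x = T_x(L)` for every
leaf `L` and every point `x` of `L`. -/

/-- `T_{1,0}(D) = T^{1,0}(M) ∩ (D ⊗ ℂ)`: the vectors `v = a + i b` with `a, b ∈ D` and
`J v = i v`. -/
def T10 (D : Distribution E M) (x : M) : Set (RT E x × RT E x) :=
  {v | v.1 ∈ D x ∧ v.2 ∈ D x ∧ cxJ x v.1 = -v.2 ∧ cxJ x v.2 = v.1}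

/-- The Levi distribution `H(D) = Re (T_{1,0}(D) ⊕ conj T_{1,0}(D))`, i.e. the largest
`J`-invariant subspace `D ∩ J D` of `D`. -/
def leviDist (D : Distribution E M) : Distribution E M := fun x =>
  D x ⊓ (D x).comap (cxJ x).toLinearMap

/-- The complex conjugate of a complex vector field. -/
def cxConj (V : CxField E M) : CxField E M := fun x => ((V x).1, -(V x).2)

/-- The complex bilinear extension of the Lie bracket to complex vector fields. -/
def cxBracket (V W : CxField E M) : CxField E M := fun x =>
  (bracket (fun y => (V y).1) (fun y => (W y).1) x - bracket (fun y => (V y).2) (fun y => (W y).2) x,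
    bracket (fun y => (V y).1) (fun y => (W y).2) x + bracket (fun y => (V y).2) (fun y => (W y).1) x)

/-- The Levi form `L(V, conj W) = i π [V, conj W]` at `x`, where `π` is the projection modulo the
Levi distribution. It takes its values in the complexification of `D x ⧸ H(D) x`, a subspace of
that of `T_x(M) ⧸ H(D) x`; as before a pair `(a, b)` stands for `a + i b`. -/
def leviForm (D : Distribution E M) (V W : CxField E M) (x : M) :
    (RT E x ⧸ leviDist D x) × (RT E x ⧸ leviDist D x) :=
  (Submodule.Quotient.mk (-(cxBracket V (cxConj W) x).2),
    Submodule.Quotient.mk (cxBracket V (cxConj W) x).1)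

section Levi

variable [IsManifold 𝓘(ℂ, E) ω M]

/-- `V` is a local `C^∞` section of `T_{1,0}(D)` around `x`. -/
def IsT10SectionAt (D : Distribution E M) (V : CxField E M) (x : M) : Prop :=
  SmoothAt (fun y => (V y).1) x ∧ SmoothAt (fun y => (V y).2) x ∧ ∀ᶠ y in 𝓝 x, V y ∈ T10 D y

/-- The vectors `v ∈ T_{1,0}(D)_x` with `L(v, conj v) = 0`. -/
def leviNull (D : Distribution E M) (x : M) : Set (RT E x × RT E x) :=
  {v | v ∈ T10 D x ∧ ∀ V : CxField E M, IsT10SectionAt D V x → V x = v → leviForm D V V x = 0}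

/-- The vectors `v ∈ T_{1,0}(D)_x` with `L(v, conj w) = 0` for all `w ∈ T_{1,0}(D)_x`. -/
def leviRadical (D : Distribution E M) (x : M) : Set (RT E x × RT E x) :=
  {v | v ∈ T10 D x ∧ ∀ V W : CxField E M, IsT10SectionAt D V x → IsT10SectionAt D W x →
    V x = v → leviForm D V W x = 0}

/-- The Levi form of the leaf `L` of `D` is degenerate (at each point of `L`). -/
def IsLeviDegenerate (D : Distribution E M) (L : Set M) : Prop :=
  ∀ x ∈ L, ∃ v ∈ leviRadical D x, v ≠ 0

/-- The leaf `L` of `D` is Levi-flat: its Levi form vanishes identically. -/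
def IsLeviFlat (D : Distribution E M) (L : Set M) : Prop :=
  ∀ x ∈ L, ∀ V W : CxField E M, IsT10SectionAt D V x → IsT10SectionAt D W x →
    leviForm D V W x = 0

/-- The (tangent bundle of the) foliation `G` of `M` extends the Levi foliation of the leaf `L` of
`D`, which is the foliation of `L` with tangent bundle `H(D)` restricted to `L`. -/
def ExtendsLeviFoliation (G D : Distribution E M) (L : Set M) : Prop :=
  ∀ x ∈ L, G x = leviDist D x

end Levi

end

end IndefLCK

/-! Write ω for the Lee form. Since `e^{-f} g` is Kähler with ω = df, the Koszul formula under a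
conformal change expresses ∇J through ω alone (`leviCivita_cxJ`). Parallelism gives dω = 0 and ∇B =
0; lightlikeness gives ω(B) = g(B, B) = 0, while ω(JB) = g(JB, B) = 0 always. Putting Y = B in the
formula yields 2 g(∇_X(JB), z) = ω(z) ω(JX) - ω(Jz) ω(X), which vanishes when z lies in H = ker ω ∩
ker(ω∘J). Differentiating g(W, JB) = -ω(JW) = 0 for sections W of H then shows that H is involutive
(`bracket_mem_leviDist`). Hence the Levi form vanishes in every dimension n ≥ 2, which is more than
the degeneracy in (1).

The same formula gives [B, JB] = ∇_B(JB) = 0, so P has a commuting frame and is involutive. Putting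
X = B instead gives ∇_B J = 0, and with ∇B = 0 this says L_B J = 0: the components of B in
holomorphic charts satisfy the Cauchy-Riemann equations. So B is a nowhere zero holomorphic frame of
P. For n = 2, P and H both have real rank 2 and P ⊆ H, so they agree.

Extending the Levi foliations of all leaves fixes the tangent bundle at every point. For a single
leaf, two holomorphic line fields coincide locally on the zero set of a holomorphic map ψ
(`exists_coincidence_map`). Along a leaf ker ω + J ker ω is the whole tangent space, so a
holomorphic map vanishing on the leaf has zero derivative there. By induction all its derivatives
vanish, hence ψ = 0 near the leaf, and the identity theorem spreads the coincidence over a connected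
M. -/

set_option linter.unusedSectionVars false

namespace IndefLCK

/-! ### Holomorphic maps of several variables: from Cauchy-Riemann to analyticity. -/

section SeveralComplexVariables

variable {E F : Type*} [NormedAddCommGroup E] [NormedSpace ℂ E]
  [NormedAddCommGroup F] [NormedSpace ℂ F]

/-- A smooth map whose real derivative commutes with `i` is complex differentiable. -/
theorem differentiableAt_complex_of_real {f : E → F} {x : E} (hf : DifferentiableAt ℝ f x)
    (hI : ∀ v, fderiv ℝ f x (Complex.I • v) = Complex.I • fderiv ℝ f x v) :
    DifferentiableAt ℂ f x := by
  let L : E →L[ℂ] F :=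
    { toFun := fderiv ℝ f x
      map_add' := map_add _
      map_smul' := fun c v => by
        have h : c • v = c.re • v + c.im • (Complex.I • v) := by
          conv_lhs => rw [← Complex.re_add_im c, add_smul, mul_smul]
          simp only [Complex.coe_smul]
        have h' : c • fderiv ℝ f x v
            = c.re • fderiv ℝ f x v + c.im • (Complex.I • fderiv ℝ f x v) := by
          conv_lhs => rw [← Complex.re_add_im c, add_smul, mul_smul]
          simp only [Complex.coe_smul]
        rw [RingHom.id_apply, h, h', map_add, map_smul, map_smul, hI]
      cont := (fderiv ℝ f x).cont }
  have h : HasFDerivAt f (L.restrictScalars ℝ) x := hf.hasFDerivAt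
  exact (hasFDerivAt_of_restrictScalars (𝕜 := ℝ) h rfl).differentiableAt

theorem fderiv_complex_apply {f : E → F} {x : E} (hf : DifferentiableAt ℂ f x) (v : E) :
    fderiv ℝ f x v = fderiv ℂ f x v := by
  rw [(hf.hasFDerivAt.restrictScalars ℝ).fderiv]; rfl

/-- A real `C^∞` holomorphic map is complex `C^∞`. -/
theorem contDiffOn_complex_of_real [FiniteDimensional ℂ E] {U : Set E} (hU : IsOpen U) (n : ℕ) :
    ∀ f : E → F, ContDiffOn ℝ ∞ f U → DifferentiableOn ℂ f U → ContDiffOn ℂ n f U := by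
  induction n with
  | zero => intro f hf _; exact contDiffOn_zero.2 hf.continuousOn
  | succ n ih =>
    intro f hf hd
    have hd' : ∀ x ∈ U, DifferentiableAt ℂ f x := fun x hx => (hd x hx).differentiableAt (hU.mem_nhds hx)
    push_cast
    refine contDiffOn_succ_of_fderiv_apply hd (by simp) fun v => ?_
    have e1 : ∀ x ∈ U, fderivWithin ℂ f U x v = fderiv ℝ f x v := fun x hx => by
      rw [fderivWithin_of_isOpen hU hx, fderiv_complex_apply (hd' x hx)]
    -- Induction applies to each directional derivative of `f`: it is again real smooth, and its
    -- holomorphy follows from the symmetry of the second derivative.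
    refine ContDiffOn.congr (ih (fun x => fderiv ℝ f x v) ?_ ?_) e1
    · exact (hf.fderiv_of_isOpen hU (m := ∞) (by simp)).clm_apply contDiffOn_const
    · intro x hx
      have hfx : ContDiffAt ℝ ∞ f x := hf.contDiffAt (hU.mem_nhds hx)
      have hsym : IsSymmSndFDerivAt ℝ f x := (contDiffAt_infty.1 hfx 2).isSymmSndFDerivAt (by simp)
      have hdd : DifferentiableAt ℝ (fderiv ℝ f) x :=
        ((contDiffAt_infty.1 hfx 2).fderiv_right (m := 1) (by norm_num)).differentiableAt (by simp)
      have key : ∀ u w : E, fderiv ℝ (fderiv ℝ f) x u (Complex.I • w)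
          = Complex.I • fderiv ℝ (fderiv ℝ f) x u w := by
        intro u w
        have h1 : (fun y => fderiv ℝ f y (Complex.I • w)) =ᶠ[𝓝 x]
            fun y => Complex.I • fderiv ℝ f y w := by
          filter_upwards [hU.mem_nhds hx] with y hy
          rw [fderiv_complex_apply (hd' y hy), fderiv_complex_apply (hd' y hy), map_smul]
        have h2 := h1.fderiv_eq (𝕜 := ℝ)
        have h3 : HasFDerivAt (fun y => fderiv ℝ f y (Complex.I • w))
          ((fderiv ℝ (fderiv ℝ f) x).flip (Complex.I • w)) x :=
            hdd.hasFDerivAt.clm_apply (hasFDerivAt_const _ _) |>.congr_fderiv (by ext; simp)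
        have h4 : HasFDerivAt (fun y => fderiv ℝ f y w)
          ((fderiv ℝ (fderiv ℝ f) x).flip w) x :=
            hdd.hasFDerivAt.clm_apply (hasFDerivAt_const _ _) |>.congr_fderiv (by ext; simp)
        have h5 := h4.const_smul Complex.I
        rw [h3.fderiv] at h2
        have h6 : fderiv ℝ (fun y => Complex.I • fderiv ℝ f y w) x = _ := h5.fderiv
        rw [h6] at h2
        exact congrArg (fun L : E →L[ℝ] F => L u) h2
      have h4 : HasFDerivAt (fun y => fderiv ℝ f y v)
          ((fderiv ℝ (fderiv ℝ f) x).flip v) x :=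
            hdd.hasFDerivAt.clm_apply (hasFDerivAt_const _ _) |>.congr_fderiv (by ext; simp)
      refine (differentiableAt_complex_of_real h4.differentiableAt fun u => ?_).differentiableWithinAt
      rw [h4.fderiv]
      simp only [ContinuousLinearMap.flip_apply]
      -- Swap the two arguments, pull `i` out of the second slot, swap back.
      rw [hsym.eq, key, hsym.eq]

/-- Cauchy estimates for the iterated derivatives of a holomorphic map. -/
theorem norm_iteratedFDeriv_le_of_bounded {f : E → F} {U : Set E} (hU : IsOpen U)
    (hf : ContDiffOn ℂ ∞ f U) {C δ : ℝ} (hδ : 0 < δ) (hC : ∀ y ∈ U, ‖f y‖ ≤ C) (k : ℕ) :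
    ∀ y, Metric.ball y (k * δ) ⊆ U → y ∈ U → ‖iteratedFDeriv ℂ k f y‖ ≤ C * (2 / δ) ^ k := by
  induction k with
  | zero => intro y _ hy; simpa using hC y hy
  | succ k ih =>
    intro y hy hyU
    have hC0 : 0 ≤ C := (norm_nonneg _).trans (hC y hyU)
    have hsub : ∀ z ∈ Metric.ball y δ, Metric.ball z (k * δ) ⊆ U ∧ z ∈ U := by
      intro z hz
      refine ⟨(Metric.ball_subset_ball' ?_).trans hy, hy (Metric.ball_subset_ball ?_ hz)⟩
      · push_cast; rw [Metric.mem_ball] at hz; linarith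
      · push_cast; nlinarith [(Nat.cast_nonneg k : (0:ℝ) ≤ k)]
    have hb : ∀ z ∈ Metric.ball y δ, ‖iteratedFDeriv ℂ k f z‖ ≤ C * (2 / δ) ^ k := fun z hz =>
      ih z (hsub z hz).1 (hsub z hz).2
    have hd : DifferentiableOn ℂ (iteratedFDeriv ℂ k f) (Metric.ball y δ) := fun z hz =>
      ((hf.contDiffAt (hU.mem_nhds (hsub z hz).2)).differentiableAt_iteratedFDeriv
        (m := k) (by exact_mod_cast ENat.natCast_lt_top k)).differentiableWithinAt
    -- Two values of the `k`-th derivative on the ball differ by at most twice its bound; dividing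
    -- by the radius `δ` gives the new factor `2 / δ`.
    have := Complex.norm_fderiv_le_div_of_mapsTo_ball hd (R₂ := 2 * (C * (2 / δ) ^ k)) (fun z hz => by
      rw [Metric.mem_closedBall, dist_eq_norm]
      refine (norm_sub_le _ _).trans ?_
      linarith [hb z hz, hb y (Metric.mem_ball_self hδ)]) hδ
    rw [norm_fderiv_iteratedFDeriv] at this
    refine this.trans (le_of_eq ?_)
    rw [pow_succ]; field_simp

/-- Restriction to complex lines reduces the Taylor expansion in several variables to the
one-variable one. -/
theorem iteratedDeriv_comp_line {f : E → F} {U : Set E} (hU : IsOpen U)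
    (hf : ContDiffOn ℂ ∞ f U) (x v : E) (k : ℕ) :
    ∀ t : ℂ, x + t • v ∈ U →
      iteratedDeriv k (fun s : ℂ => f (x + s • v)) t = iteratedFDeriv ℂ k f (x + t • v) fun _ => v := by
  induction k with
  | zero => intro t _; simp
  | succ k ih =>
    intro t ht
    rw [iteratedDeriv_succ]
    have hev : iteratedDeriv k (fun s : ℂ => f (x + s • v)) =ᶠ[𝓝 t]
        fun s => iteratedFDeriv ℂ k f (x + s • v) fun _ => v := by
      have hc : ContinuousAt (fun s : ℂ => x + s • v) t := by fun_prop
      filter_upwards [hc.preimage_mem_nhds (hU.mem_nhds ht)] with s hs using ih s hs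
    rw [hev.deriv_eq]
    exact ((hf.contDiffAt (hU.mem_nhds ht)).of_le (by exact_mod_cast le_top)).deriv_fderiv_add_smul

/-- A `C^∞` holomorphic map is analytic. -/
theorem analyticAt_of_contDiffOn [CompleteSpace F] {f : E → F} {U : Set E} (hU : IsOpen U)
    (hf : ContDiffOn ℂ ∞ f U) {x : E} (hx : x ∈ U) : AnalyticAt ℂ f x := by
  obtain ⟨R, hR, hRU⟩ : ∃ R > 0, Metric.ball x R ⊆ U ∩ {y | ‖f y‖ ≤ ‖f x‖ + 1} := by
    refine Metric.mem_nhds_iff.1 (Filter.inter_mem (hU.mem_nhds hx) ?_)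
    have hc : ContinuousAt (fun y => ‖f y‖) x :=
      ((hf.contDiffAt (hU.mem_nhds hx)).continuousAt).norm
    exact (hc.eventually (gt_mem_nhds (lt_add_one _))).mono fun y hy => le_of_lt hy
  set C := ‖f x‖ + 1
  have hC : 0 ≤ C := by positivity
  have hfB : ContDiffOn ℂ ∞ f (Metric.ball x R) := hf.mono fun y hy => (hRU hy).1
  -- The radius `R` is spent in `k` equal steps of length `R / k`.
  have hbound : ∀ k : ℕ, ‖iteratedFDeriv ℂ k f x‖ ≤ C * (2 * k / R) ^ k := by
    intro k
    rcases Nat.eq_zero_or_pos k with rfl | hk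
    · simpa using (hRU (Metric.mem_ball_self hR)).2
    · have hk' : (0 : ℝ) < k := by exact_mod_cast hk
      have := norm_iteratedFDeriv_le_of_bounded Metric.isOpen_ball hfB (δ := R / k) (by positivity)
        (fun y hy => (hRU hy).2) k x (by rw [mul_div_cancel₀ _ hk'.ne']) (Metric.mem_ball_self hR)
      refine this.trans (le_of_eq ?_)
      congr 2; field_simp
  let p : FormalMultilinearSeries ℂ E F := fun k => ((k.factorial : ℂ)⁻¹) • iteratedFDeriv ℂ k f x
  have hp : ∀ k, ‖p k‖ * (R / (2 * Real.exp 1)) ^ k ≤ C := by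
    intro k
    have h1 : ‖p k‖ = (k.factorial : ℝ)⁻¹ * ‖iteratedFDeriv ℂ k f x‖ := by
      simp only [p, norm_smul, norm_inv, Complex.norm_natCast]
    -- This turns the growth `k ^ k / k!` of the Cauchy bounds into a geometric one, whence the
    -- radius `R / (2e)`.
    have h2 : (k : ℝ) ^ k / k.factorial ≤ Real.exp 1 ^ k := by
      rw [← Real.exp_nat_mul, mul_one]; exact Real.pow_div_factorial_le_exp _ (Nat.cast_nonneg k) k
    have hpos : (0 : ℝ) < k.factorial := by exact_mod_cast k.factorial_pos
    rw [h1]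
    calc (k.factorial : ℝ)⁻¹ * ‖iteratedFDeriv ℂ k f x‖ * (R / (2 * Real.exp 1)) ^ k
        ≤ (k.factorial : ℝ)⁻¹ * (C * (2 * k / R) ^ k) * (R / (2 * Real.exp 1)) ^ k := by
          gcongr; exact hbound k
      _ = C * (((k : ℝ) ^ k / k.factorial) / Real.exp 1 ^ k) := by
          rw [div_pow, div_pow, mul_pow, mul_pow]; field_simp
      _ ≤ C * 1 := by
          gcongr; exact div_le_one_of_le₀ h2 (by positivity)
      _ = C := mul_one C
  set r : ℝ := R / (2 * Real.exp 1)
  have hr : 0 < r := by positivity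
  have hrR : r ≤ R := div_le_self hR.le (by nlinarith [Real.add_one_le_exp (1:ℝ)])
  refine ⟨p, ENNReal.ofReal r, ?_, ENNReal.ofReal_pos.2 hr, ?_⟩
  · refine p.le_radius_of_bound C (r := r.toNNReal) fun k => ?_
    rw [Real.coe_toNNReal _ hr.le]; exact hp k
  · intro v hv
    rw [Metric.eball_ofReal, mem_ball_zero_iff] at hv
    have hvR : ‖v‖ < R := hv.trans_le hrR
    -- The slice `t ↦ f (x + t v)` must be holomorphic on a disc of radius larger than 1, because
    -- its Taylor series is evaluated at `t = 1`.
    obtain ⟨ρ, hρ1, hρ⟩ : ∃ ρ : ℝ, 1 < ρ ∧ ρ * ‖v‖ < R := by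
      rcases (norm_nonneg v).eq_or_lt with h0 | h0
      · exact ⟨2, by norm_num, by rw [← h0]; simpa⟩
      · obtain ⟨ρ, h1, h2⟩ := exists_between ((one_lt_div h0).2 hvR)
        exact ⟨ρ, h1, (lt_div_iff₀ h0).1 h2⟩
    have hmem : ∀ t ∈ Metric.ball (0 : ℂ) ρ, x + t • v ∈ Metric.ball x R := by
      intro t ht
      rw [mem_ball_zero_iff] at ht
      rw [Metric.mem_ball, dist_eq_norm, add_sub_cancel_left, norm_smul]
      exact (mul_le_mul_of_nonneg_right ht.le (norm_nonneg v)).trans_lt hρ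
    have hd : DifferentiableOn ℂ (fun t : ℂ => f (x + t • v)) (Metric.ball 0 ρ) := by
      refine DifferentiableOn.comp (hfB.differentiableOn (by simp)) ?_ hmem
      fun_prop
    have hs := Complex.hasSum_taylorSeries_on_ball hd (z := 1) (by simpa using hρ1)
    simp only [sub_zero, one_pow, one_smul] at hs
    convert hs using 2 with k
    rw [iteratedDeriv_comp_line Metric.isOpen_ball hfB x v k 0 (by simpa using hR)]
    simp [p]

end SeveralComplexVariables

end IndefLCK

namespace IndefLCK

variable {E : Type*} [NormedAddCommGroup E] [NormedSpace ℂ E]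
  {M : Type*} [TopologicalSpace M] [ChartedSpace E M]

/-! ### Directional derivatives of real functions on the manifold. -/

section Calculus

theorem dirDeriv_eq (f : M → ℝ) (x : M) (v : RT E x) : dirDeriv f x v = mvfderiv 𝓘(ℝ, E) f x v :=
  rfl

theorem dirDeriv_add_apply (f : M → ℝ) (x : M) (v w : RT E x) :
    dirDeriv f x (v + w) = dirDeriv f x v + dirDeriv f x w := by
  simp only [dirDeriv_eq, map_add]

theorem dirDeriv_smul_apply (f : M → ℝ) (x : M) (c : ℝ) (v : RT E x) :
    dirDeriv f x (c • v) = c * dirDeriv f x v := by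
  simp only [dirDeriv_eq, map_smul, smul_eq_mul]

theorem dirDeriv_add {f h : M → ℝ} {x : M} (hf : MDifferentiableAt 𝓘(ℝ, E) 𝓘(ℝ, ℝ) f x)
    (hh : MDifferentiableAt 𝓘(ℝ, E) 𝓘(ℝ, ℝ) h x) (v : RT E x) :
    dirDeriv (fun y => f y + h y) x v = dirDeriv f x v + dirDeriv h x v := by
  simp only [dirDeriv_eq]
  exact congrArg (fun L : RT E x →L[ℝ] ℝ => L v) (mvfderiv_add hf hh)

theorem dirDeriv_mul {f h : M → ℝ} {x : M} (hf : MDifferentiableAt 𝓘(ℝ, E) 𝓘(ℝ, ℝ) f x)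
    (hh : MDifferentiableAt 𝓘(ℝ, E) 𝓘(ℝ, ℝ) h x) (v : RT E x) :
    dirDeriv (fun y => f y * h y) x v = f x * dirDeriv h x v + h x * dirDeriv f x v := by
  simp only [dirDeriv_eq]
  have := congrArg (fun L : RT E x →L[ℝ] ℝ => L v) (mvfderiv_mul hf hh)
  exact this

theorem dirDeriv_congr {f h : M → ℝ} {x : M} (hfh : f =ᶠ[𝓝 x] h) (v : RT E x) :
    dirDeriv f x v = dirDeriv h x v := by
  simp only [dirDeriv]
  rw [hfh.mfderiv_eq]
  rfl

theorem dirDeriv_eq_zero {f : M → ℝ} {x : M} (hf : ∀ᶠ y in 𝓝 x, f y = 0) (v : RT E x) :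
    dirDeriv f x v = 0 := by
  rw [dirDeriv_congr (h := fun _ => 0) hf v, dirDeriv_eq, mvfderiv_const]; rfl

theorem mdifferentiableAt_exp_neg {f : M → ℝ} {x : M} (hf : MDifferentiableAt 𝓘(ℝ, E) 𝓘(ℝ, ℝ) f x) :
    MDifferentiableAt 𝓘(ℝ, E) 𝓘(ℝ, ℝ) (fun y => Real.exp (-f y)) x :=
  (DifferentiableAt.mdifferentiableAt (f := fun t : ℝ => Real.exp (-t)) (by fun_prop)).comp x hf

theorem dirDeriv_exp_neg {f : M → ℝ} {x : M} (hf : MDifferentiableAt 𝓘(ℝ, E) 𝓘(ℝ, ℝ) f x)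
    (v : RT E x) :
    dirDeriv (fun y => Real.exp (-f y)) x v = -Real.exp (-f x) * dirDeriv f x v := by
  have h1 : HasDerivAt (fun t : ℝ => Real.exp (-t)) (-Real.exp (-f x)) (f x) := by
    simpa using (hasDerivAt_neg (f x)).exp
  have h2 := (h1.hasFDerivAt.hasMFDerivAt).comp x hf.hasMFDerivAt
  have h3 : mfderiv 𝓘(ℝ, E) 𝓘(ℝ, ℝ) (fun y => Real.exp (-f y)) x = _ := h2.mfderiv
  simp only [dirDeriv]
  rw [h3]
  exact mul_comm (dirDeriv f x v) (-Real.exp (-f x))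

end Calculus

/-! ### The complex structure and vector fields in a fixed holomorphic chart. -/

section ComplexStructure

@[simp] theorem cxJ_cxJ (x : M) (v : RT E x) : cxJ x (cxJ x v) = -v := by
  have h (u : E) : Complex.I • (Complex.I • u) = -u := by
    rw [smul_smul, Complex.I_mul_I, neg_one_smul]
  exact h v

variable [IsManifold 𝓘(ℂ, E) ω M]

/-- The coordinates of a tangent vector at `y` in the preferred holomorphic chart at `x`. -/
noncomputable def coord (x y : M) : RT E y →L[ℝ] E :=
  (trivializationAt E (TangentSpace 𝓘(ℝ, E)) x).continuousLinearMapAt ℝ y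

theorem mem_baseSet (x y : M) : y ∈ (trivializationAt E (TangentSpace 𝓘(ℝ, E)) x).baseSet ↔
    y ∈ (chartAt E x).source := Iff.rfl

theorem coord_eq_trivialization {x y : M} (hy : y ∈ (chartAt E x).source) (v : RT E y) :
    coord x y v = (trivializationAt E (TangentSpace 𝓘(ℝ, E)) x ⟨y, v⟩).2 := by
  unfold coord
  rw [Bundle.Trivialization.continuousLinearMapAt_apply, Bundle.Trivialization.linearMapAt_apply,
    if_pos ((mem_baseSet x y).2 hy)]

theorem differentiableAt_transition {x y : M} (hy : y ∈ (chartAt E x).source) :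
    DifferentiableAt ℂ (chartAt E x ∘ (chartAt E y).symm) (chartAt E y y) := by
  have h := (contDiffGroupoid ω 𝓘(ℂ, E)).compatible (chart_mem_atlas E y) (chart_mem_atlas E x)
  rw [contDiffGroupoid, mem_groupoid_of_pregroupoid] at h
  have h1 : ContDiffOn ℂ ω (chartAt E x ∘ (chartAt E y).symm)
      ((chartAt E y).symm.trans (chartAt E x)).source := by
    refine h.1.congr_mono (fun _ _ => rfl) ?_
    simp
  refine (h1.contDiffAt (((chartAt E y).symm.trans (chartAt E x)).open_source.mem_nhds ?_)).differentiableAt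
    (by simp)
  simp [hy]

/-- The real trivialization is the derivative of a holomorphic transition map, so it is complex
linear. -/
theorem coord_eq_complex {x y : M} (hy : y ∈ (chartAt E x).source) (v : RT E y) :
    coord x y v = fderiv ℂ (chartAt E x ∘ (chartAt E y).symm) (chartAt E y y) (v : E) := by
  rw [coord_eq_trivialization hy, TangentBundle.trivializationAt_apply]
  refine Eq.trans ?_ (fderiv_complex_apply (differentiableAt_transition hy) (v : E))
  simp only [modelWithCornersSelf_coe, range_id, fderivWithin_univ]
  rfl

/-- The real and the complex tangent bundle are trivialized by the same maps, so holomorphy of a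
field can be read off from `coord`. -/
theorem coord_eq_complex_trivialization {x y : M} (hy : y ∈ (chartAt E x).source) (v : RT E y) :
    coord x y v =
      (trivializationAt E (TangentSpace 𝓘(ℂ, E)) x ⟨y, (v : TangentSpace 𝓘(ℂ, E) y)⟩).2 := by
  rw [coord_eq_complex hy, TangentBundle.trivializationAt_apply]
  simp only [modelWithCornersSelf_coe, range_id, fderivWithin_univ]
  rfl

/-- `cxJ` is multiplication by `i` in a chart that varies with the point; complex linearity of
transitions makes it multiplication by `i` in one fixed chart, hence a smooth tensor. -/
theorem coord_cxJ {x y : M} (hy : y ∈ (chartAt E x).source) (v : RT E y) :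
    coord x y (cxJ y v) = Complex.I • coord x y v := by
  rw [coord_eq_complex hy, coord_eq_complex hy]
  exact (fderiv ℂ (chartAt E x ∘ (chartAt E y).symm) (chartAt E y y)).map_smul Complex.I (v : E)

theorem coord_injective {x y : M} (hy : y ∈ (chartAt E x).source) :
    Function.Injective (coord (E := E) x y) := by
  intro v w h
  have := ((trivializationAt E (TangentSpace 𝓘(ℝ, E)) x).continuousLinearEquivAt ℝ y hy).injective
  rw [coord_eq_trivialization hy, coord_eq_trivialization hy] at h
  exact this h

theorem coord_self (x : M) (v : RT E x) : coord x x v = v := by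
  rw [coord_eq_trivialization (mem_chart_source E x), TangentBundle.trivializationAt_apply]
  have h : ((chartAt E x).extend 𝓘(ℝ, E) ∘ ((chartAt E x).extend 𝓘(ℝ, E)).symm)
      =ᶠ[𝓝 ((chartAt E x).extend 𝓘(ℝ, E) x)] id := by
    filter_upwards [(chartAt E x).open_target.mem_nhds (mem_chart_target E x)] with z hz
    simp [hz]
  simp only [modelWithCornersSelf_coe, range_id, fderivWithin_univ]
  rw [h.fderiv_eq, fderiv_id]
  rfl

theorem smoothAt_iff_coord {X : VField E M} {x : M} :
    SmoothAt X x ↔ ContMDiffAt 𝓘(ℝ, E) 𝓘(ℝ, E) ∞ (fun y => coord x y (X y)) x := by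
  unfold SmoothAt
  rw [Bundle.contMDiffAt_section]
  refine Filter.EventuallyEq.contMDiffAt_iff ?_
  filter_upwards [(chartAt E x).open_source.mem_nhds (mem_chart_source E x)] with y hy
  rw [coord_eq_trivialization hy]

theorem diffAt_iff_coord {X : VField E M} {x : M} :
    DiffAt X x ↔ MDifferentiableAt 𝓘(ℝ, E) 𝓘(ℝ, E) (fun y => coord x y (X y)) x := by
  unfold DiffAt
  rw [mdifferentiableAt_section]
  refine Filter.EventuallyEq.mdifferentiableAt_iff ?_
  filter_upwards [(chartAt E x).open_source.mem_nhds (mem_chart_source E x)] with y hy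
  rw [coord_eq_trivialization hy]

theorem SmoothAt.diffAt {X : VField E M} {x : M} (h : SmoothAt X x) : DiffAt X x :=
  ContMDiffAt.mdifferentiableAt h (by simp)

theorem SmoothAt.cxJ {X : VField E M} {x : M} (h : SmoothAt X x) :
    SmoothAt (fun y => cxJ y (X y)) x := by
  rw [smoothAt_iff_coord] at h ⊢
  have h1 : ContMDiffAt 𝓘(ℝ, E) 𝓘(ℝ, E) ∞
      (fun y => (Complex.I • ContinuousLinearMap.id ℝ E : E →L[ℝ] E) (coord x y (X y))) x :=
    ((Complex.I • ContinuousLinearMap.id ℝ E : E →L[ℝ] E).contMDiff.contMDiffAt).comp x h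
  refine h1.congr_of_eventuallyEq ?_
  filter_upwards [(chartAt E x).open_source.mem_nhds (mem_chart_source E x)] with y hy
  rw [coord_cxJ hy]; rfl

theorem DiffAt.cxJ {X : VField E M} {x : M} (h : DiffAt X x) :
    DiffAt (fun y => cxJ y (X y)) x := by
  rw [diffAt_iff_coord] at h ⊢
  have h1 : MDifferentiableAt 𝓘(ℝ, E) 𝓘(ℝ, E)
      (fun y => (Complex.I • ContinuousLinearMap.id ℝ E : E →L[ℝ] E) (coord x y (X y))) x :=
    ((Complex.I • ContinuousLinearMap.id ℝ E : E →L[ℝ] E).mdifferentiableAt).comp x h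
  refine h1.congr_of_eventuallyEq ?_
  filter_upwards [(chartAt E x).open_source.mem_nhds (mem_chart_source E x)] with y hy
  rw [coord_cxJ hy]; rfl

theorem DiffAt.smul {X : VField E M} {f : M → ℝ} {x : M}
    (hf : MDifferentiableAt 𝓘(ℝ, E) 𝓘(ℝ, ℝ) f x) (hX : DiffAt X x) :
    DiffAt (fun y => f y • X y) x := MDifferentiableAt.smul_section hf hX

theorem SmoothAt.add {X Y : VField E M} {x : M} (hX : SmoothAt X x) (hY : SmoothAt Y x) :
    SmoothAt (fun y => X y + Y y) x := ContMDiffAt.add_section hX hY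

theorem SmoothAt.neg {X : VField E M} {x : M} (hX : SmoothAt X x) :
    SmoothAt (fun y => -X y) x := ContMDiffAt.neg_section hX

theorem SmoothAt.smul {X : VField E M} {f : M → ℝ} {x : M}
    (hf : ContMDiffAt 𝓘(ℝ, E) 𝓘(ℝ, ℝ) ∞ f x) (hX : SmoothAt X x) :
    SmoothAt (fun y => f y • X y) x := ContMDiffAt.smul_section hf hX

/-- The local extension of a tangent vector by constant coordinates. -/
noncomputable def ext {x : M} (v : RT E x) : VField E M := FiberBundle.extend E v

@[simp] theorem ext_self {x : M} (v : RT E x) : ext v x = v := FiberBundle.extend_apply_self _ _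

theorem coord_ext {x y : M} (v : RT E x) (hy : y ∈ (chartAt E x).source) :
    coord x y (ext v y) = v := by
  rw [coord_eq_trivialization hy]
  simp only [ext, FiberBundle.extend]
  rw [Bundle.Trivialization.apply_mk_symm _ ((mem_baseSet x y).2 hy)]
  rw [← coord_eq_trivialization (mem_chart_source E x), coord_self]

theorem smoothAt_ext {x : M} (v : RT E x) : SmoothAt (ext v) x :=
  FiberBundle.contMDiffAt_extend 𝓘(ℝ, E) E v

/-- Smoothness on the whole chart domain, not only at its centre, is what local frames require. -/
theorem smoothAt_ext_of_mem {x y : M} (v : RT E x) (hy : y ∈ (chartAt E x).source) :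
    SmoothAt (ext v) y := by
  unfold SmoothAt
  rw [Bundle.Trivialization.contMDiffAt_section_iff
    (e := trivializationAt E (TangentSpace 𝓘(ℝ, E)) x) ((mem_baseSet x y).2 hy)]
  have h : ContMDiffAt 𝓘(ℝ, E) 𝓘(ℝ, E) ∞ (fun _ : M => (id v : E)) y := contMDiffAt_const
  refine h.congr_of_eventuallyEq ?_
  filter_upwards [(chartAt E x).open_source.mem_nhds hy] with z hz
  rw [← coord_eq_trivialization hz, coord_ext v hz]
  rfl

end ComplexStructure

section Bilinear

variable [IsManifold 𝓘(ℂ, E) ω M]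

theorem SmoothBilin.smoothAt_apply {g : BilinField E M} (hg : SmoothBilin g) {X Y : VField E M} {x : M}
    (hX : SmoothAt X x) (hY : SmoothAt Y x) :
    ContMDiffAt 𝓘(ℝ, E) 𝓘(ℝ, ℝ) ∞ (fun y => g y (X y) (Y y)) x := by
  have : ContMDiffAt 𝓘(ℝ, E) (𝓘(ℝ, E).prod 𝓘(ℝ, ℝ)) ∞
      (fun m => Bundle.TotalSpace.mk' ℝ (E := Bundle.Trivial M ℝ) m (g m (X m) (Y m))) x :=
    ContMDiffAt.clm_bundle_apply₂ (F₁ := E) (F₂ := E) hg.contMDiffAt hX hY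
  simp only [Bundle.contMDiffAt_section] at this
  exact this

theorem SmoothBilin.diffAt_apply {g : BilinField E M} (hg : SmoothBilin g) {X Y : VField E M} {x : M}
    (hX : DiffAt X x) (hY : DiffAt Y x) :
    MDifferentiableAt 𝓘(ℝ, E) 𝓘(ℝ, ℝ) (fun y => g y (X y) (Y y)) x := by
  have : MDifferentiableAt 𝓘(ℝ, E) (𝓘(ℝ, E).prod 𝓘(ℝ, ℝ))
      (fun m => Bundle.TotalSpace.mk' ℝ (E := Bundle.Trivial M ℝ) m (g m (X m) (Y m))) x :=
    MDifferentiableAt.clm_bundle_apply₂ (F₁ := E) (F₂ := E)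
      (hg.contMDiffAt.mdifferentiableAt (by simp)) hX hY
  simp only [mdifferentiableAt_section] at this
  exact this

end Bilinear

end IndefLCK

namespace IndefLCK

variable {E : Type*} [NormedAddCommGroup E] [NormedSpace ℂ E] [FiniteDimensional ℂ E]
  {M : Type*} [TopologicalSpace M] [ChartedSpace E M] [IsManifold 𝓘(ℂ, E) ω M]

/-! ### Algebra of the Lie bracket. -/

section Bracket

variable {X Y Z : VField E M} {x : M}

theorem bracket_swap (X Y : VField E M) (x : M) : bracket X Y x = -bracket Y X x :=
  VectorField.mlieBracket_swap_apply

theorem bracket_congr {X' Y' : VField E M} (hX : X =ᶠ[𝓝 x] X') (hY : Y =ᶠ[𝓝 x] Y') :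
    bracket X Y x = bracket X' Y' x :=
  hX.mlieBracket_vectorField_eq hY

theorem bracket_add_right (hY : DiffAt Y x) (hZ : DiffAt Z x) :
    bracket X (fun y => Y y + Z y) x = bracket X Y x + bracket X Z x :=
  haveI : CompleteSpace E := FiniteDimensional.complete ℂ E
  VectorField.mlieBracket_add_right hY hZ

theorem bracket_smul_right {f : M → ℝ} (hf : MDifferentiableAt 𝓘(ℝ, E) 𝓘(ℝ, ℝ) f x)
    (hY : DiffAt Y x) :
    bracket X (fun y => f y • Y y) x = dirDeriv f x (X x) • Y x + f x • bracket X Y x :=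
  haveI : CompleteSpace E := FiniteDimensional.complete ℂ E
  VectorField.mlieBracket_smul_right hf hY

theorem bracket_add_left (hY : DiffAt Y x) (hZ : DiffAt Z x) :
    bracket (fun y => Y y + Z y) X x = bracket Y X x + bracket Z X x :=
  haveI : CompleteSpace E := FiniteDimensional.complete ℂ E
  VectorField.mlieBracket_add_left hY hZ

theorem bracket_smul_left {f : M → ℝ} (hf : MDifferentiableAt 𝓘(ℝ, E) 𝓘(ℝ, ℝ) f x)
    (hY : DiffAt Y x) :
    bracket (fun y => f y • Y y) X x = -dirDeriv f x (X x) • Y x + f x • bracket Y X x :=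
  haveI : CompleteSpace E := FiniteDimensional.complete ℂ E
  VectorField.mlieBracket_smul_left hf hY

end Bracket

/-- The field of bilinear forms `g` is symmetric, differentiable at `x` and nondegenerate at `x`. -/
structure IsMetricAt (g : BilinField E M) (x : M) : Prop where
  diff : ∀ X Y : VField E M, DiffAt X x → DiffAt Y x →
    MDifferentiableAt 𝓘(ℝ, E) 𝓘(ℝ, ℝ) (fun y => g y (X y) (Y y)) x
  symm : ∀ (y : M) (v w : RT E y), g y v w = g y w v
  nondegenerate : ∀ v : RT E x, (∀ w : RT E x, g x v w = 0) → v = 0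

/-! ### The Levi-Civita connection from the Koszul formula, and its conformal change. -/

section LeviCivita

variable {g : BilinField E M} {x : M}

/-- Replacing `Z` by `f Z`, the derivatives of `f` from the product rule cancel those from the
brackets. The Koszul expression is thus a linear form in `Z x`, to be represented by a vector. -/
theorem tensorialAt_koszul (hg : IsMetricAt g x) {X Y : VField E M} (hX : DiffAt X x)
    (hY : DiffAt Y x) : TensorialAt 𝓘(ℝ, E) E (fun Z : VField E M => koszul g X Y Z x) x where
  smul := by
    intro f Z hf hZ
    have h1 : dirDeriv (fun y => g y (Y y) (f y • Z y)) x (X x)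
        = f x * dirDeriv (fun y => g y (Y y) (Z y)) x (X x)
          + g x (Y x) (Z x) * dirDeriv f x (X x) := by
      rw [← dirDeriv_mul hf (hg.diff Y Z hY hZ)]; simp only [map_smul, smul_eq_mul]
    have h2 : dirDeriv (fun y => g y (X y) (f y • Z y)) x (Y x)
        = f x * dirDeriv (fun y => g y (X y) (Z y)) x (Y x)
          + g x (X x) (Z x) * dirDeriv f x (Y x) := by
      rw [← dirDeriv_mul hf (hg.diff X Z hX hZ)]; simp only [map_smul, smul_eq_mul]
    change koszul g X Y (fun y => f y • Z y) x = f x • koszul g X Y Z x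
    unfold koszul
    rw [h1, h2, bracket_smul_right hf hZ, bracket_smul_right hf hZ, dirDeriv_smul_apply]
    simp only [map_add, map_smul, add_apply, smul_apply, smul_eq_mul]
    rw [hg.symm x (Z x) (Y x), hg.symm x (Z x) (X x)]
    ring
  add := by
    intro Z Z' hZ hZ'
    have h1 : dirDeriv (fun y => g y (Y y) (Z y + Z' y)) x (X x)
        = dirDeriv (fun y => g y (Y y) (Z y)) x (X x)
          + dirDeriv (fun y => g y (Y y) (Z' y)) x (X x) := by
      rw [← dirDeriv_add (hg.diff Y Z hY hZ) (hg.diff Y Z' hY hZ')]; simp only [map_add]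
    have h2 : dirDeriv (fun y => g y (X y) (Z y + Z' y)) x (Y x)
        = dirDeriv (fun y => g y (X y) (Z y)) x (Y x)
          + dirDeriv (fun y => g y (X y) (Z' y)) x (Y x) := by
      rw [← dirDeriv_add (hg.diff X Z hX hZ) (hg.diff X Z' hX hZ')]; simp only [map_add]
    change koszul g X Y (fun y => Z y + Z' y) x = koszul g X Y Z x + koszul g X Y Z' x
    unfold koszul
    rw [h1, h2, bracket_add_right hZ hZ', bracket_add_right hZ hZ', dirDeriv_add_apply]
    simp only [map_add, add_apply]
    ring

instance finiteDimensional_tangentSpace (x : M) : FiniteDimensional ℝ (RT E x) := inferInstanceAs (FiniteDimensional ℝ E)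

theorem exists_representative {x : M} (hg : ∀ v : RT E x, (∀ w : RT E x, g x v w = 0) → v = 0)
    (L : RT E x →ₗ[ℝ] ℝ) : ∃ v : RT E x, ∀ w, g x v w = L w := by
  let G : RT E x →ₗ[ℝ] Module.Dual ℝ (RT E x) :=
    { toFun := fun v => (g x v).toLinearMap
      map_add' := fun v w => by ext; simp
      map_smul' := fun c v => by ext; simp }
  have hinj : Function.Injective G := by
    rw [← LinearMap.ker_eq_bot, LinearMap.ker_eq_bot']
    intro v hv
    exact hg v fun w => congrArg (fun L : Module.Dual ℝ (RT E x) => L w) hv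
  have hsurj := (LinearMap.injective_iff_surjective_of_finrank_eq_finrank
    (Subspace.dual_finrank_eq (K := ℝ) (V := RT E x)).symm).1 hinj
  obtain ⟨v, hv⟩ := hsurj L
  exact ⟨v, fun w => congrArg (fun L : Module.Dual ℝ (RT E x) => L w) hv⟩

/-- Tensoriality and nondegeneracy supply the vector, so the default value 0 in `leviCivita` is not
the branch taken. -/
theorem leviCivita_spec (hg : IsMetricAt g x) {X Y Z : VField E M} (hX : DiffAt X x)
    (hY : DiffAt Y x) (hZ : DiffAt Z x) :
    2 * g x (leviCivita g X Y x) (Z x) = koszul g X Y Z x := by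
  have h : ∃ v : RT E x, ∀ Z : VField E M, DiffAt Z x → 2 * g x v (Z x) = koszul g X Y Z x := by
    have hT := tensorialAt_koszul hg hX hY
    obtain ⟨v, hv⟩ := exists_representative hg.nondegenerate
      ((2 : ℝ)⁻¹ • (TensorialAt.mkHom (I := 𝓘(ℝ, E)) (F := E) _ x hT).toLinearMap)
    refine ⟨v, fun Z hZ => ?_⟩
    rw [hv, LinearMap.smul_apply, smul_eq_mul, mul_inv_cancel_left₀ two_ne_zero]
    exact TensorialAt.mkHom_apply hT hZ
  unfold leviCivita
  rw [dif_pos h]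
  exact h.choose_spec Z hZ

/-- In the sum of the Koszul formulas for `Y, Z` and `Z, Y` everything cancels except `2 X g(Y, Z)`.
-/
theorem leviCivita_metric (hg : IsMetricAt g x) {X Y Z : VField E M} (hX : DiffAt X x)
    (hY : DiffAt Y x) (hZ : DiffAt Z x) :
    dirDeriv (fun y => g y (Y y) (Z y)) x (X x) =
      g x (leviCivita g X Y x) (Z x) + g x (Y x) (leviCivita g X Z x) := by
  have h1 := leviCivita_spec hg hX hY hZ
  have h2 := leviCivita_spec hg hX hZ hY
  have e1 : (fun y => g y (Z y) (Y y)) = fun y => g y (Y y) (Z y) := funext fun y => hg.symm y _ _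
  unfold koszul at h1 h2
  rw [e1, bracket_swap Z Y, map_neg, neg_apply] at h2
  rw [hg.symm x (Y x)]
  linarith

/-- In the difference of the Koszul formulas for `X, Y` and `Y, X` only `2 g([X, Y], Z)` survives.
-/
theorem leviCivita_torsion (hg : IsMetricAt g x) {X Y : VField E M} (hX : DiffAt X x)
    (hY : DiffAt Y x) : bracket X Y x = leviCivita g X Y x - leviCivita g Y X x := by
  refine sub_eq_zero.1 (hg.nondegenerate _ fun z => ?_)
  have hZ : DiffAt (ext z) x := (smoothAt_ext z).diffAt
  have h1 := leviCivita_spec hg hX hY hZ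
  have h2 := leviCivita_spec hg hY hX hZ
  have e1 : (fun y => g y (Y y) (X y)) = fun y => g y (X y) (Y y) := funext fun y => hg.symm y _ _
  unfold koszul at h1 h2
  rw [e1, bracket_swap Y X, map_neg, neg_apply] at h2
  simp only [ext_self] at h1 h2
  simp only [map_sub, sub_apply]
  linarith

/-- The factor `f` is controlled only on an open set, so `e^{-f} g` need not be a smooth metric on
all of `M`; this is why the metric hypotheses are localized at a point. -/
theorem IsMetricAt.conformal (hg : IsMetricAt g x) {f : M → ℝ}
    (hf : MDifferentiableAt 𝓘(ℝ, E) 𝓘(ℝ, ℝ) f x) :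
    IsMetricAt (fun y => Real.exp (-f y) • g y) x where
  diff X Y hX hY := by
    have := MDifferentiableAt.mul (mdifferentiableAt_exp_neg hf) (hg.diff X Y hX hY)
    exact this
  symm y v w := by
    simp only [smul_apply]; rw [hg.symm]
  nondegenerate v hv := by
    refine hg.nondegenerate v fun w => ?_
    have := hv w
    simp only [smul_apply, smul_eq_mul] at this
    exact (mul_eq_zero.1 this).resolve_left (Real.exp_pos _).ne'

/-- The product rule adds a multiple of `df` to each derivative term of the Koszul formula, while
bracket terms are only rescaled; then `e^{-f}` cancels. -/
theorem leviCivita_conformal (hg : IsMetricAt g x) {f : M → ℝ}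
    (hf : MDifferentiableAt 𝓘(ℝ, E) 𝓘(ℝ, ℝ) f x) {X Y : VField E M}
    (hX : DiffAt X x) (hY : DiffAt Y x) (z : RT E x) :
    2 * g x (leviCivita (fun y => Real.exp (-f y) • g y) X Y x) z =
      2 * g x (leviCivita g X Y x) z - dirDeriv f x (X x) * g x (Y x) z
        - dirDeriv f x (Y x) * g x (X x) z + dirDeriv f x z * g x (X x) (Y x) := by
  have hZ : DiffAt (ext z) x := (smoothAt_ext z).diffAt
  have h1 := leviCivita_spec hg hX hY hZ
  have h2 := leviCivita_spec (hg.conformal hf) hX hY hZ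
  have e : ∀ V W : VField E M, DiffAt V x → DiffAt W x → ∀ u : RT E x,
      dirDeriv (fun y => (Real.exp (-f y) • g y) (V y) (W y)) x u =
        Real.exp (-f x) * dirDeriv (fun y => g y (V y) (W y)) x u
          + g x (V x) (W x) * (-Real.exp (-f x) * dirDeriv f x u) := by
    intro V W hV hW u
    rw [← dirDeriv_exp_neg hf, ← dirDeriv_mul (mdifferentiableAt_exp_neg hf) (hg.diff V W hV hW)]
    rfl
  unfold koszul at h1 h2
  rw [e Y _ hY hZ, e X _ hX hZ, e X Y hX hY] at h2
  simp only [smul_apply, smul_eq_mul, ext_self] at h1 h2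
  have hpos := (Real.exp_pos (-f x)).ne'
  refine mul_left_cancel₀ hpos ?_
  linear_combination h2 - Real.exp (-f x) * h1

end LeviCivita

/-! ### The derivative of J, and the Lee form and Lee field. -/

section LocallyConformalKahler

variable {g : BilinField E M} {ν : ℕ} {x : M}

theorem IsIndefHermitian.isMetricAt (hg : IsIndefHermitian g ν) (x : M) : IsMetricAt g x where
  diff _ _ hX hY := hg.smooth.diffAt_apply hX hY
  symm := hg.symm
  nondegenerate := hg.nondegenerate x

theorem IsIndefHermitian.cxJ_left (hg : IsIndefHermitian g ν) (v w : RT E x) :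
    g x (cxJ x v) w = -g x v (cxJ x w) := by
  have := hg.hermitian x v (cxJ x w)
  rw [cxJ_cxJ, map_neg] at this
  linarith

theorem IsIndefHermitian.cxJ_self (hg : IsIndefHermitian g ν) (v : RT E x) :
    g x (cxJ x v) v = 0 := by
  have := hg.cxJ_left v v
  rw [hg.symm x v] at this
  linarith

theorem IsLocalConformalFactor.mdifferentiableAt {U : Set M} {f : M → ℝ}
    (hf : IsLocalConformalFactor g U f) (hx : x ∈ U) :
    MDifferentiableAt 𝓘(ℝ, E) 𝓘(ℝ, ℝ) f x :=
  (hf.2.1.contMDiffAt (hf.1.mem_nhds hx)).mdifferentiableAt (by simp)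

/-- The derivative of the complex structure of a metric conformal to a Kähler metric. -/
theorem leviCivita_cxJ (hg : IsIndefHermitian g ν) {U : Set M} {f : M → ℝ}
    (hf : IsLocalConformalFactor g U f) (hx : x ∈ U) {X Y : VField E M}
    (hX : SmoothAt X x) (hY : SmoothAt Y x) (z : RT E x) :
    2 * g x (leviCivita g X (fun y => cxJ y (Y y)) x) z
        + 2 * g x (leviCivita g X Y x) (cxJ x z) =
      dirDeriv f x (cxJ x (Y x)) * g x (X x) z - dirDeriv f x z * g x (X x) (cxJ x (Y x))
        + dirDeriv f x (Y x) * g x (X x) (cxJ x z)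
        - dirDeriv f x (cxJ x z) * g x (X x) (Y x) := by
  have hdf := hf.mdifferentiableAt hx
  have hm := hg.isMetricAt x
  have h1 := leviCivita_conformal hm hdf hX.diffAt hY.diffAt (cxJ x z)
  have h2 := leviCivita_conformal hm hdf hX.diffAt hY.cxJ.diffAt z
  have h3 := hf.2.2 x hx X Y hX hY
  rw [h3, hg.cxJ_left, hg.cxJ_left] at h2
  linarith

/-- If `α u ≠ 0`, the relation with `y = u` reads `(α(Ju) + i α(u)) z = (α(Jz) + i α(z)) u`. Every
`z` would then be a complex multiple of `u`, forcing dimension at most 1. -/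
theorem eq_zero_of_two_le_finrank (hn : 2 ≤ Module.finrank ℂ E) (α : RT E x →L[ℝ] ℝ)
    (h : ∀ y z : RT E x, α (cxJ x y) • z - α z • cxJ x y + α y • cxJ x z - α (cxJ x z) • y = 0) :
    α = 0 := by
  by_contra hα
  obtain ⟨u, hu⟩ : ∃ u, α u ≠ 0 := by
    by_contra! hc
    exact hα (ContinuousLinearMap.ext hc)
  have h' : ∀ z : E, ∃ c : ℂ, c • (id u : E) = z := by
    intro z
    have hz : ((α (cxJ x u) : ℝ) • z - (α z : ℝ) • (Complex.I • (id u : E)) + (α u : ℝ) • (Complex.I • z)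
      - (α (cxJ x z) : ℝ) • (id u : E) : E) = 0 := h u z
    set a := α (cxJ x u)
    set b := α u
    have hc : (a : ℂ) + b * Complex.I ≠ 0 := by
      intro h0
      have := congrArg Complex.im h0
      simp at this
      exact hu this
    refine ⟨((a : ℂ) + b * Complex.I)⁻¹ * (α z * Complex.I + α (cxJ x z)), ?_⟩
    rw [mul_smul, inv_smul_eq_iff₀ hc]
    simp only [add_smul, mul_smul, Complex.coe_smul]
    rw [← sub_eq_zero, ← neg_eq_zero, ← hz]
    abel
  have := finrank_le_one (R := ℂ) (id u : E) h'
  omega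

/-- The left side of `leviCivita_cxJ` does not involve the conformal factor. Subtracting it for `f`
and `f'` and removing `g` by nondegeneracy gives the relation of `eq_zero_of_two_le_finrank` for `df
- df'`. -/
theorem mfderiv_conformalFactor_unique (hn : 2 ≤ Module.finrank ℂ E) (hg : IsIndefHermitian g ν)
    {U U' : Set M} {f f' : M → ℝ} (hf : IsLocalConformalFactor g U f)
    (hf' : IsLocalConformalFactor g U' f') (hx : x ∈ U) (hx' : x ∈ U') (v : RT E x) :
    dirDeriv f x v = dirDeriv f' x v := by
  let α : RT E x →L[ℝ] ℝ := mvfderiv 𝓘(ℝ, E) f x - mvfderiv 𝓘(ℝ, E) f' x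
  have hα : ∀ v, α v = dirDeriv f x v - dirDeriv f' x v := fun v => rfl
  have : α = 0 := by
    refine eq_zero_of_two_le_finrank hn α fun y z => hg.nondegenerate x _ fun w => ?_
    have h1 := leviCivita_cxJ hg hf hx (smoothAt_ext w) (smoothAt_ext y) z
    have h2 := leviCivita_cxJ hg hf' hx' (smoothAt_ext w) (smoothAt_ext y) z
    simp only [ext_self] at h1 h2
    rw [hg.symm]
    simp only [map_add, map_sub, map_smul, smul_eq_mul, hα]
    linarith
  have := congrArg (fun L : RT E x →L[ℝ] ℝ => L v) this
  simp only [hα, zero_apply] at this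
  linarith

theorem leeForm_eq_dirDeriv (hn : 2 ≤ Module.finrank ℂ E) (hg : IsIndefHermitian g ν)
    {U : Set M} {f : M → ℝ} (hf : IsLocalConformalFactor g U f) (hx : x ∈ U) (v : RT E x) :
    leeForm g x v = dirDeriv f x v := by
  have h : ∃ (f : M → ℝ) (U : Set M), x ∈ U ∧ IsLocalConformalFactor g U f := ⟨f, U, hx, hf⟩
  obtain ⟨U', hx', hf'⟩ := h.choose_spec
  rw [← mfderiv_conformalFactor_unique hn hg hf' hf hx' hx]
  have e : leeForm g x = mvfderiv 𝓘(ℝ, E) h.choose x := dif_pos h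
  rw [e]
  rfl

theorem leeField_spec (hg : IsIndefHermitian g ν) (v : RT E x) :
    g x v (leeField g x) = leeForm g x v := by
  have h : ∃ b : RT E x, ∀ v : RT E x, g x v b = leeForm g x v := by
    obtain ⟨b, hb⟩ := exists_representative (hg.nondegenerate x) (leeForm g x).toLinearMap
    exact ⟨b, fun v => by rw [hg.symm, hb]; rfl⟩
  unfold leeField
  rw [dif_pos h]
  exact h.choose_spec v

end LocallyConformalKahler

end IndefLCK

namespace IndefLCK

variable {E : Type*} [NormedAddCommGroup E] [NormedSpace ℂ E] [FiniteDimensional ℂ E]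
  {M : Type*} [TopologicalSpace M] [ChartedSpace E M] [IsManifold 𝓘(ℂ, E) ω M]

/-! ### Coordinate expressions of the metric and of differentials. -/

section Smoothness

theorem coord_surjective {x y : M} (hy : y ∈ (chartAt E x).source) :
    Function.Surjective (coord (E := E) x y) := by
  intro a
  obtain ⟨v, hv⟩ :=
    ((trivializationAt E (TangentSpace 𝓘(ℝ, E)) x).continuousLinearEquivAt ℝ y hy).surjective a
  exact ⟨v, by rw [coord_eq_trivialization hy]; exact hv⟩

/-- A matrix of the metric with values in one fixed space, so that it can be inverted smoothly to
obtain the Lee field. -/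
theorem SmoothBilin.exists_coord {g : BilinField E M} (hg : SmoothBilin g) (x : M) :
    ∃ β : M → E →L[ℝ] E →L[ℝ] ℝ, ContMDiffAt 𝓘(ℝ, E) 𝓘(ℝ, E →L[ℝ] E →L[ℝ] ℝ) ∞ β x ∧
      ∀ y ∈ (chartAt E x).source, ∀ v w : RT E y, β y (coord x y v) (coord x y w) = g y v w := by
  have h := hg.contMDiffAt (x := x)
  rw [Bundle.contMDiffAt_section] at h
  refine ⟨_, h, fun y hy v w => ?_⟩
  have e : ∀ u : RT E y, (trivializationAt E (TangentSpace 𝓘(ℝ, E)) x).symm y (coord x y u) = u := by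
    intro u
    rw [coord_eq_trivialization hy]
    exact Bundle.Trivialization.symm_apply_apply_mk _ ((mem_baseSet x y).2 hy) u
  rw [hom_trivializationAt_apply]
  simp only [ContinuousLinearMap.inCoordinates]
  rw [ContinuousLinearMap.comp_apply, ContinuousLinearMap.comp_apply,
    Bundle.Trivialization.symmL_apply, e]
  rw [Bundle.Trivialization.continuousLinearMapAt_apply, Bundle.Trivialization.linearMapAt_apply,
    if_pos (by simpa using hy), hom_trivializationAt_apply]
  simp only [ContinuousLinearMap.inCoordinates]
  rw [ContinuousLinearMap.comp_apply, ContinuousLinearMap.comp_apply,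
    Bundle.Trivialization.symmL_apply, e]
  · simp
  all_goals exact (mem_baseSet x y).2 hy

/-- The chart is centred at `x`, not at the point of differentiation, so that `y` may vary in a
fixed chart. -/
theorem dirDeriv_eq_fderiv {f : M → ℝ} {x y : M} (hy : y ∈ (chartAt E x).source)
    (hf : MDifferentiableAt 𝓘(ℝ, E) 𝓘(ℝ, ℝ) f y) (v : RT E y) :
    dirDeriv f y v = fderiv ℝ (f ∘ (chartAt E x).symm) (chartAt E x y) (coord x y v) := by
  have hc : coord x y = mfderiv 𝓘(ℝ, E) 𝓘(ℝ, E) (extChartAt 𝓘(ℝ, E) x) y :=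
    TangentBundle.continuousLinearMapAt_trivializationAt hy
  have hφ : MDifferentiableAt 𝓘(ℝ, E) 𝓘(ℝ, E) (chartAt E x) y :=
    mdifferentiableAt_atlas (chart_mem_atlas E x) hy
  have hs : MDifferentiableAt 𝓘(ℝ, E) 𝓘(ℝ, E) (chartAt E x).symm (chartAt E x y) :=
    mdifferentiableAt_atlas_symm (chart_mem_atlas E x) ((chartAt E x).map_source hy)
  have hfs : MDifferentiableAt 𝓘(ℝ, E) 𝓘(ℝ, ℝ) (f ∘ (chartAt E x).symm) (chartAt E x y) := by
    refine MDifferentiableAt.comp _ ?_ hs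
    rwa [(chartAt E x).left_inv hy]
  have he : f =ᶠ[𝓝 y] (f ∘ (chartAt E x).symm) ∘ chartAt E x := by
    filter_upwards [(chartAt E x).open_source.mem_nhds hy] with z hz
    simp [hz]
  have h1 : mfderiv 𝓘(ℝ, E) 𝓘(ℝ, ℝ) ((f ∘ (chartAt E x).symm) ∘ chartAt E x) y = _ :=
    mfderiv_comp y hfs hφ
  rw [dirDeriv_congr he]
  unfold dirDeriv
  rw [h1, mfderiv_eq_fderiv, hc]
  rfl

theorem contDiffAt_comp_chart_symm {f : M → ℝ} {x y : M} (hy : y ∈ (chartAt E x).source)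
    (hf : ContMDiffAt 𝓘(ℝ, E) 𝓘(ℝ, ℝ) ∞ f y) :
    ContDiffAt ℝ ∞ (f ∘ (chartAt E x).symm) (chartAt E x y) := by
  rw [← contMDiffAt_iff_contDiffAt]
  have hs : ContMDiffAt 𝓘(ℝ, E) 𝓘(ℝ, E) ∞ (chartAt E x).symm (chartAt E x y) :=
    (contMDiffOn_chart_symm (I := 𝓘(ℝ, E)) (n := ∞) (x := x)).contMDiffAt
      ((chartAt E x).open_target.mem_nhds ((chartAt E x).map_source hy))
  refine ContMDiffAt.comp _ ?_ hs
  rwa [(chartAt E x).left_inv hy]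

end Smoothness

/-- `g` is a locally conformal Kähler indefinite Hermitian metric of complex dimension at least `2`
with parallel Lee form and lightlike Lee field. -/
structure IsLightlikeParallelLCK (g : BilinField E M) (ν : ℕ) : Prop where
  two_le : 2 ≤ Module.finrank ℂ E
  hermitian : IsIndefHermitian g ν
  lck : IsLCK g
  parallel : IsParallelForm g (leeForm g)
  lightlike : IsLightlike g (leeField g)

/-! ### Parallelism of the Lee field and vanishing of the Levi form. -/

namespace IsLightlikeParallelLCK

variable {g : BilinField E M} {ν : ℕ} {x : M} (h : IsLightlikeParallelLCK g ν)

include h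

theorem exists_potential (x : M) : ∃ (U : Set M) (f : M → ℝ), x ∈ U ∧ IsOpen U ∧
    ContMDiffOn 𝓘(ℝ, E) 𝓘(ℝ, ℝ) ∞ f U ∧ ∀ y ∈ U, ∀ v : RT E y, leeForm g y v = dirDeriv f y v := by
  obtain ⟨U, f, hx, hf⟩ := h.lck x
  exact ⟨U, f, hx, hf.1, hf.2.1, fun y hy v => leeForm_eq_dirDeriv h.two_le h.hermitian hf hy v⟩

/-- The Lee form in the holomorphic chart at `x`. -/
theorem exists_leeForm_coord (x : M) :
    ∃ α : M → E →L[ℝ] ℝ, ContMDiffAt 𝓘(ℝ, E) 𝓘(ℝ, E →L[ℝ] ℝ) ∞ α x ∧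
      ∀ᶠ y in 𝓝 x, ∀ v : RT E y, leeForm g y v = α y (coord x y v) := by
  obtain ⟨U, f, hxU, hU, hf, hfe⟩ := h.exists_potential x
  have hx := mem_chart_source E x
  refine ⟨fun y => fderiv ℝ (f ∘ (chartAt E x).symm) (chartAt E x y), ?_, ?_⟩
  · have h1 := contDiffAt_comp_chart_symm hx (hf.contMDiffAt (hU.mem_nhds hxU))
    have h2 : ContDiffAt ℝ ∞ (fderiv ℝ (f ∘ (chartAt E x).symm)) (chartAt E x x) :=
      h1.fderiv_right (by simp)
    have h3 : ContMDiffAt 𝓘(ℝ, E) 𝓘(ℝ, E) ∞ (chartAt E x) x :=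
      (contMDiffOn_chart (I := 𝓘(ℝ, E)) (n := ∞) (x := x)).contMDiffAt
        ((chartAt E x).open_source.mem_nhds hx)
    exact h2.contMDiffAt.comp x h3
  · filter_upwards [hU.mem_nhds hxU, (chartAt E x).open_source.mem_nhds hx] with y hyU hy v
    rw [hfe y hyU, dirDeriv_eq_fderiv hy
      ((hf.contMDiffAt (hU.mem_nhds hyU)).mdifferentiableAt (by simp))]

theorem smoothAt_leeForm {X : VField E M} (hX : SmoothAt X x) :
    ContMDiffAt 𝓘(ℝ, E) 𝓘(ℝ, ℝ) ∞ (fun y => leeForm g y (X y)) x := by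
  obtain ⟨α, hα, he⟩ := h.exists_leeForm_coord x
  rw [smoothAt_iff_coord] at hX
  refine (hα.clm_apply hX).congr_of_eventuallyEq ?_
  filter_upwards [he] with y hy using hy _

/-- The Lee field is smooth. -/
theorem smoothAt_leeField (x : M) : SmoothAt (leeField g) x := by
  obtain ⟨α, hα, hαe⟩ := h.exists_leeForm_coord x
  obtain ⟨β, hβ, hβe⟩ := h.hermitian.smooth.exists_coord x
  have hinv : ∀ y ∈ (chartAt E x).source, ∃ e : E ≃L[ℝ] (E →L[ℝ] ℝ),
      (e : E →L[ℝ] E →L[ℝ] ℝ) = β y := by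
    intro y hy
    have hinj : Function.Injective (β y) := by
      rw [injective_iff_map_eq_zero]
      intro a ha
      obtain ⟨v, rfl⟩ := coord_surjective hy a
      rw [h.hermitian.nondegenerate y v fun w => by rw [← hβe y hy, ha]; rfl, map_zero]
    have hdim : Module.finrank ℝ E = Module.finrank ℝ (E →L[ℝ] ℝ) := by
      rw [← Subspace.dual_finrank_eq (K := ℝ) (V := E)]
      exact (LinearMap.toContinuousLinearMap (𝕜 := ℝ) (E := E) (F' := ℝ)).finrank_eq
    exact ⟨(LinearEquiv.ofInjectiveOfFinrankEq (β y).toLinearMap hinj hdim).toContinuousLinearEquiv,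
      by ext; rfl⟩
  have : CompleteSpace E := FiniteDimensional.complete ℂ E
  rw [smoothAt_iff_coord]
  obtain ⟨e, he⟩ := hinv x (mem_chart_source E x)
  -- In coordinates the Lee field is `β⁻¹ α`, and inversion is smooth at invertible maps.
  have h1 : ContDiffAt ℝ ∞ ContinuousLinearMap.inverse (β x) := by
    rw [← he]; exact contDiffAt_map_inverse e
  have h2 : ContMDiffAt 𝓘(ℝ, E) 𝓘(ℝ, (E →L[ℝ] ℝ) →L[ℝ] E) ∞
      (fun y => ContinuousLinearMap.inverse (β y)) x := h1.contMDiffAt.comp x hβ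
  refine (h2.clm_apply hα).congr_of_eventuallyEq ?_
  filter_upwards [hαe, (chartAt E x).open_source.mem_nhds (mem_chart_source E x)] with y hy1 hy2
  obtain ⟨e, he⟩ := hinv y hy2
  rw [← he, ContinuousLinearMap.inverse_equiv, ContinuousLinearEquiv.coe_coe,
    ContinuousLinearEquiv.eq_symm_apply]
  ext a
  obtain ⟨v, rfl⟩ := coord_surjective hy2 a
  have : e (coord x y (leeField g y)) = β y (coord x y (leeField g y)) := by rw [← he]; rfl
  rw [this, hβe y hy2, ← hy1, h.hermitian.symm, leeField_spec h.hermitian]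

/-- Lightlikeness enters here: it makes the Lee field tangent to its own orthogonal complement ker
ω. -/
theorem leeForm_leeField (x : M) : leeForm g x (leeField g x) = 0 := by
  rw [← leeField_spec h.hermitian]; exact (h.lightlike x).2

theorem leeForm_cxJ_leeField (x : M) : leeForm g x (cxJ x (leeField g x)) = 0 := by
  rw [← leeField_spec h.hermitian]; exact h.hermitian.cxJ_self _

theorem apply_cxJ_leeField (v : RT E x) : g x v (cxJ x (leeField g x)) = -leeForm g x (cxJ x v) := by
  rw [← leeField_spec h.hermitian, h.hermitian.cxJ_left, neg_neg]

/-- A form parallel for a torsion-free connection is closed; this yields involutivity of ker ω. -/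
theorem leeForm_bracket {X Y : VField E M} (hX : SmoothAt X x) (hY : SmoothAt Y x) :
    leeForm g x (bracket X Y x) = dirDeriv (fun y => leeForm g y (Y y)) x (X x)
      - dirDeriv (fun y => leeForm g y (X y)) x (Y x) := by
  rw [leviCivita_torsion (h.hermitian.isMetricAt x) hX.diffAt hY.diffAt, map_sub,
    h.parallel x X Y hX hY, h.parallel x Y X hY hX]

/-- The metric is parallel, so the dual of a parallel form is parallel. -/
theorem leviCivita_leeField {X : VField E M} (hX : SmoothAt X x) :
    leviCivita g X (leeField g) x = 0 := by
  refine h.hermitian.nondegenerate x _ fun z => ?_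
  have hZ := smoothAt_ext z
  have h1 := leviCivita_metric (h.hermitian.isMetricAt x) hX.diffAt (h.smoothAt_leeField x).diffAt
    hZ.diffAt
  have h2 := h.parallel x X (ext z) hX hZ
  have e : (fun y => g y (leeField g y) (ext z y)) = fun y => leeForm g y (ext z y) :=
    funext fun y => by rw [h.hermitian.symm, leeField_spec h.hermitian]
  rw [e, h2, h.hermitian.symm x (leeField g x), leeField_spec h.hermitian, ext_self] at h1
  linarith

theorem leviCivita_cxJ {X Y : VField E M} (hX : SmoothAt X x) (hY : SmoothAt Y x) (z : RT E x) :
    2 * g x (leviCivita g X (fun y => cxJ y (Y y)) x) z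
        + 2 * g x (leviCivita g X Y x) (cxJ x z) =
      leeForm g x (cxJ x (Y x)) * g x (X x) z - leeForm g x z * g x (X x) (cxJ x (Y x))
        + leeForm g x (Y x) * g x (X x) (cxJ x z)
        - leeForm g x (cxJ x z) * g x (X x) (Y x) := by
  obtain ⟨U, f, hxU, hf⟩ := h.lck x
  simp only [leeForm_eq_dirDeriv h.two_le h.hermitian hf hxU]
  exact IndefLCK.leviCivita_cxJ h.hermitian hf hxU hX hY z

/-- Take `Y = B` in the formula for ∇J: ∇B = 0 and ω(B) = ω(JB) = 0 leave two terms. -/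
theorem leviCivita_cxJ_leeField {X : VField E M} (hX : SmoothAt X x) (z : RT E x) :
    2 * g x (leviCivita g X (fun y => cxJ y (leeField g y)) x) z =
      leeForm g x z * leeForm g x (cxJ x (X x)) - leeForm g x (cxJ x z) * leeForm g x (X x) := by
  have := h.leviCivita_cxJ hX (h.smoothAt_leeField x) z
  rw [h.leviCivita_leeField hX, h.leeForm_leeField, h.leeForm_cxJ_leeField, h.apply_cxJ_leeField,
    leeField_spec h.hermitian] at this
  simp only [map_zero, zero_apply] at this
  linarith

/-- The Levi distribution of the first canonical foliation is involutive. -/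
theorem bracket_mem_leviDist {X Y : VField E M} (hX : SmoothAt X x) (hY : SmoothAt Y x)
    (hXD : ∀ᶠ y in 𝓝 x, X y ∈ leviDist (firstFoliation g) y)
    (hYD : ∀ᶠ y in 𝓝 x, Y y ∈ leviDist (firstFoliation g) y) :
    bracket X Y x ∈ leviDist (firstFoliation g) x := by
  have hX1 : ∀ᶠ y in 𝓝 x, leeForm g y (X y) = 0 := hXD.mono fun y hy => hy.1
  have hX2 : ∀ᶠ y in 𝓝 x, leeForm g y (cxJ y (X y)) = 0 := hXD.mono fun y hy => hy.2
  have hY1 : ∀ᶠ y in 𝓝 x, leeForm g y (Y y) = 0 := hYD.mono fun y hy => hy.1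
  have hY2 : ∀ᶠ y in 𝓝 x, leeForm g y (cxJ y (Y y)) = 0 := hYD.mono fun y hy => hy.2
  refine ⟨?_, ?_⟩
  · change leeForm g x _ = 0
    rw [h.leeForm_bracket hX hY, dirDeriv_eq_zero hX1, dirDeriv_eq_zero hY1, sub_zero]
  · change leeForm g x (cxJ x _) = 0
    -- Differentiate g(W, JB) = -ω(JW) = 0 along `V`. Since ω(W) = ω(JW) = 0,
    -- `leviCivita_cxJ_leeField` kills g(W, ∇_V(JB)), leaving g(∇_V W, JB) = 0.
    have key : ∀ {V W : VField E M}, SmoothAt V x → SmoothAt W x →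
        (∀ᶠ y in 𝓝 x, leeForm g y (W y) = 0) → (∀ᶠ y in 𝓝 x, leeForm g y (cxJ y (W y)) = 0) →
        g x (leviCivita g V W x) (cxJ x (leeField g x)) = 0 := by
      intro V W hV hW hW1 hW2
      have h1 := leviCivita_metric (h.hermitian.isMetricAt x) hV.diffAt hW.diffAt
        (h.smoothAt_leeField x).cxJ.diffAt
      have h2 := h.leviCivita_cxJ_leeField hV (W x)
      rw [dirDeriv_eq_zero (hW2.mono fun y hy => by rw [h.apply_cxJ_leeField, hy, neg_zero])] at h1
      rw [hW1.self_of_nhds, hW2.self_of_nhds, h.hermitian.symm] at h2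
      linarith
    rw [← neg_eq_zero, ← h.apply_cxJ_leeField,
      leviCivita_torsion (h.hermitian.isMetricAt x) hX.diffAt hY.diffAt, map_sub, sub_apply,
      key hX hY hY1 hY2, key hY hX hX1 hX2, sub_zero]

/-- Real and imaginary parts of a section of `T10` lie in the involutive Levi distribution, so every
bracket dies in the quotient. No restriction to complex dimension two is needed. -/
theorem leviForm_eq_zero {V W : CxField E M} (hV : IsT10SectionAt (firstFoliation g) V x)
    (hW : IsT10SectionAt (firstFoliation g) W x) : leviForm (firstFoliation g) V W x = 0 := by
  have hmem : ∀ {V : CxField E M} {y : M}, V y ∈ T10 (firstFoliation g) y →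
      (V y).1 ∈ leviDist (firstFoliation g) y ∧ (V y).2 ∈ leviDist (firstFoliation g) y := by
    rintro V y ⟨h1, h2, h3, h4⟩
    refine ⟨⟨h1, ?_⟩, ⟨h2, ?_⟩⟩
    · change cxJ y (V y).1 ∈ firstFoliation g y
      rw [h3]; exact neg_mem h2
    · change cxJ y (V y).2 ∈ firstFoliation g y
      rw [h4]; exact h1
  have hV1 := hV.2.2.mono fun y hy => (hmem hy).1
  have hV2 := hV.2.2.mono fun y hy => (hmem hy).2
  have hW1 := hW.2.2.mono fun y hy => (hmem hy).1
  have hW2 := hW.2.2.mono fun y hy => neg_mem (hmem hy).2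
  unfold leviForm cxBracket cxConj
  refine Prod.ext ?_ ?_
  · refine (Submodule.Quotient.mk_eq_zero _).2 (neg_mem (add_mem ?_ ?_))
    · exact h.bracket_mem_leviDist hV.1 hW.2.1.neg hV1 hW2
    · exact h.bracket_mem_leviDist hV.2.1 hW.1 hV2 hW1
  · refine (Submodule.Quotient.mk_eq_zero _).2 (sub_mem ?_ ?_)
    · exact h.bracket_mem_leviDist hV.1 hW.1 hV1 hW1
    · exact h.bracket_mem_leviDist hV.2.1 hW.2.1.neg hV2 hW2

theorem leeZ_ne_zero (x : M) : leeZ g x ≠ 0 := fun h0 =>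
  (h.lightlike x).1 (congrArg Prod.fst h0)

theorem leeZ_mem_T10 (x : M) : leeZ g x ∈ T10 (firstFoliation g) x := by
  refine ⟨h.leeForm_leeField x, ?_, ?_, ?_⟩
  · change leeForm g x (-_) = 0
    rw [map_neg, h.leeForm_cxJ_leeField, neg_zero]
  · simp [leeZ, antiLeeField]
  · simp [leeZ, antiLeeField]

end IsLightlikeParallelLCK

end IndefLCK

/-! ### The two canonical foliations. -/

namespace IndefLCK

variable {E : Type*} [NormedAddCommGroup E] [NormedSpace ℂ E] [FiniteDimensional ℂ E]
  {M : Type*} [TopologicalSpace M] [ChartedSpace E M] [IsManifold 𝓘(ℂ, E) ω M]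

/-- Leaves are generated by tangent curves, and a larger distribution admits more of them. -/
theorem leaf_mono {D D' : Distribution E M} (h : ∀ x, D x ≤ D' x) (x : M) :
    leaf D x ⊆ leaf D' x := by
  have hle : TangentJoined D ≤ TangentJoined D' := fun _ _ ⟨γ, h1, h2, h3, h4⟩ =>
    ⟨γ, h1, h2, h3, fun t => h _ (h4 t)⟩
  exact fun y hy => Relation.EqvGen.mono hle x y hy

theorem mem_secondFoliation {g : BilinField E M} {x : M} {v : RT E x} :
    v ∈ secondFoliation g x ↔ ∃ a b : ℝ, a • leeField g x + b • cxJ x (leeField g x) = v := by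
  unfold secondFoliation
  rw [Submodule.mem_span_pair]
  constructor
  · rintro ⟨a, b, rfl⟩
    exact ⟨b, -a, by rw [antiLeeField]; module⟩
  · rintro ⟨a, b, rfl⟩
    exact ⟨-b, a, by rw [antiLeeField]; module⟩

namespace IsLightlikeParallelLCK

variable {g : BilinField E M} {ν : ℕ} {x : M} (h : IsLightlikeParallelLCK g ν)

include h

theorem leeForm_ne_zero (x : M) : leeForm g x ≠ 0 := fun h0 =>
  (h.lightlike x).1 (h.hermitian.nondegenerate x _ fun w => by
    rw [h.hermitian.symm, leeField_spec h.hermitian, h0]; rfl)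

theorem exists_leeForm_ne_zero (x : M) : ∃ c : RT E x, leeForm g x c ≠ 0 := by
  by_contra! hc
  exact h.leeForm_ne_zero x (ContinuousLinearMap.ext hc)

/-- The coefficients of a smooth section of the second canonical foliation are differentiable. -/
theorem exists_coefficients {X : VField E M} (hX : SmoothAt X x)
    (hXP : ∀ᶠ y in 𝓝 x, X y ∈ secondFoliation g y) :
    ∃ a b : M → ℝ, MDifferentiableAt 𝓘(ℝ, E) 𝓘(ℝ, ℝ) a x ∧
      MDifferentiableAt 𝓘(ℝ, E) 𝓘(ℝ, ℝ) b x ∧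
      X =ᶠ[𝓝 x] fun y => a y • leeField g y + b y • cxJ y (leeField g y) := by
  obtain ⟨c, hc⟩ := h.exists_leeForm_ne_zero x
  have hC := smoothAt_ext c
  have hB := h.smoothAt_leeField x
  have hs := h.hermitian.smooth
  let p : M → ℝ := fun y => g y (leeField g y) (ext c y)
  let q : M → ℝ := fun y => g y (cxJ y (leeField g y)) (ext c y)
  let r : M → ℝ := fun y => g y (X y) (ext c y)
  let t : M → ℝ := fun y => g y (X y) (cxJ y (ext c y))
  have hp : ContMDiffAt 𝓘(ℝ, E) 𝓘(ℝ, ℝ) ∞ p x := hs.smoothAt_apply hB hC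
  have hq : ContMDiffAt 𝓘(ℝ, E) 𝓘(ℝ, ℝ) ∞ q x := hs.smoothAt_apply hB.cxJ hC
  have hr : ContMDiffAt 𝓘(ℝ, E) 𝓘(ℝ, ℝ) ∞ r x := hs.smoothAt_apply hX hC
  have ht : ContMDiffAt 𝓘(ℝ, E) 𝓘(ℝ, ℝ) ∞ t x := hs.smoothAt_apply hX hC.cxJ
  have hpx : p x ≠ 0 := by
    simp only [p, ext_self]
    rwa [h.hermitian.symm, leeField_spec h.hermitian]
  have hd0 : ∀ {y}, p y ≠ 0 → p y * p y + q y * q y ≠ 0 := fun {y} hy =>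
    (add_pos_of_pos_of_nonneg (mul_self_pos.2 hy) (mul_self_nonneg _)).ne'
  have hd : ContMDiffAt 𝓘(ℝ, E) 𝓘(ℝ, ℝ) ∞ (fun y => p y * p y + q y * q y) x :=
    (hp.mul hp).add (hq.mul hq)
  -- Pairing `X = a B + b JB` with `c` and `Jc` gives `r = a p + b q` and `t = -a q + b p`. Cramer's
  -- rule has determinant `p² + q²`, nonzero near `x` because `p x = ω(c)`.
  refine ⟨fun y => (p y * r y - q y * t y) / (p y * p y + q y * q y),
    fun y => (q y * r y + p y * t y) / (p y * p y + q y * q y),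
    ((((hp.mul hr).sub (hq.mul ht)).div₀ hd (hd0 hpx)).mdifferentiableAt (by simp)),
    ((((hq.mul hr).add (hp.mul ht)).div₀ hd (hd0 hpx)).mdifferentiableAt (by simp)), ?_⟩
  filter_upwards [hXP, hp.continuousAt.eventually_ne hpx] with y hy hpy
  obtain ⟨a, b, hab⟩ := mem_secondFoliation.1 hy
  have e1 : r y = a * p y + b * q y := by
    simp only [r, p, q, ← hab, map_add, map_smul, add_apply, smul_apply, smul_eq_mul]
  have e2 : t y = -a * q y + b * p y := by
    simp only [t, p, q, ← hab, map_add, map_smul, add_apply, smul_apply, smul_eq_mul,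
      h.hermitian.hermitian, h.hermitian.cxJ_left]
    ring
  have hy0 := hd0 hpy
  have ea : (p y * r y - q y * t y) / (p y * p y + q y * q y) = a := by
    rw [div_eq_iff hy0, e1, e2]; ring
  have eb : (q y * r y + p y * t y) / (p y * p y + q y * q y) = b := by
    rw [div_eq_iff hy0, e1, e2]; ring
  rw [ea, eb, hab]

/-- The bracket is ∇_B(JB), since ∇B = 0, and it vanishes because ω(B) = ω(JB) = 0. -/
theorem bracket_cxJ_leeField (x : M) :
    bracket (leeField g) (fun y => cxJ y (leeField g y)) x = 0 := by
  have hB := h.smoothAt_leeField x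
  rw [leviCivita_torsion (h.hermitian.isMetricAt x) hB.diffAt hB.cxJ.diffAt,
    h.leviCivita_leeField hB.cxJ, sub_zero]
  refine h.hermitian.nondegenerate x _ fun z => ?_
  have := h.leviCivita_cxJ_leeField hB z
  rw [h.leeForm_leeField, h.leeForm_cxJ_leeField] at this
  linarith

/-- In the commuting frame B, JB, a bracket of two sections involves only derivatives of the
coefficients. -/
theorem bracket_mem_secondFoliation {X Y : VField E M} (hX : SmoothAt X x) (hY : SmoothAt Y x)
    (hXP : ∀ᶠ y in 𝓝 x, X y ∈ secondFoliation g y)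
    (hYP : ∀ᶠ y in 𝓝 x, Y y ∈ secondFoliation g y) :
    bracket X Y x ∈ secondFoliation g x := by
  obtain ⟨a, b, ha, hb, hXe⟩ := h.exists_coefficients hX hXP
  obtain ⟨c, d, hc, hd, hYe⟩ := h.exists_coefficients hY hYP
  have hB : DiffAt (leeField g) x := (h.smoothAt_leeField x).diffAt
  have hJB : DiffAt (fun y => cxJ y (leeField g y)) x := hB.cxJ
  have hmB : leeField g x ∈ secondFoliation g x := mem_secondFoliation.2 ⟨1, 0, by simp⟩
  have hmJ : cxJ x (leeField g x) ∈ secondFoliation g x := mem_secondFoliation.2 ⟨0, 1, by simp⟩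
  have key : ∀ W : VField E M, bracket W (leeField g) x = 0 →
      bracket W (fun y => cxJ y (leeField g y)) x = 0 →
      bracket W Y x ∈ secondFoliation g x := by
    intro W h1 h2
    rw [bracket_congr (Filter.EventuallyEq.refl _ W) hYe,
      bracket_add_right (DiffAt.smul hc hB) (DiffAt.smul hd hJB), bracket_smul_right hc hB,
      bracket_smul_right hd hJB, h1, h2, smul_zero, smul_zero, add_zero, add_zero]
    exact add_mem (Submodule.smul_mem _ _ hmB) (Submodule.smul_mem _ _ hmJ)
  have h0 : bracket (leeField g) (leeField g) x = 0 := by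
    have : bracket (leeField g) (leeField g) = 0 := VectorField.mlieBracket_self
    rw [this]; rfl
  have h0' : bracket (fun y => cxJ y (leeField g y)) (fun y => cxJ y (leeField g y)) x = 0 := by
    have : bracket (fun y => cxJ y (leeField g y)) (fun y => cxJ y (leeField g y)) = 0 :=
      VectorField.mlieBracket_self
    rw [this]; rfl
  have h1 := key (leeField g) h0 (h.bracket_cxJ_leeField x)
  have h2 := key (fun y => cxJ y (leeField g y))
    (by rw [bracket_swap, h.bracket_cxJ_leeField, neg_zero]) h0'
  rw [bracket_congr hXe (Filter.EventuallyEq.refl _ Y),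
    bracket_add_left (DiffAt.smul ha hB) (DiffAt.smul hb hJB), bracket_smul_left ha hB,
    bracket_smul_left hb hJB]
  exact add_mem (add_mem (Submodule.smul_mem _ _ hmB) (Submodule.smul_mem _ _ h1))
    (add_mem (Submodule.smul_mem _ _ hmJ) (Submodule.smul_mem _ _ h2))

/-- From `t B = s JB`, applying J gives `(t² + s²) B = 0`. -/
theorem linearIndependent_leeField (x : M) :
    LinearIndependent ℝ ![antiLeeField g x, leeField g x] := by
  rw [LinearIndependent.pair_iff]
  intro s t hst
  have h1 : t • leeField g x = s • cxJ x (leeField g x) := by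
    rw [antiLeeField] at hst
    rw [← sub_eq_zero, ← hst]; module
  have h2 := congrArg (cxJ x) h1
  simp only [map_smul, cxJ_cxJ] at h2
  have h3 : (t * t + s * s) • leeField g x = 0 := by
    calc (t * t + s * s) • leeField g x = t • (t • leeField g x) - s • (s • -leeField g x) := by
          module
      _ = 0 := by rw [h1, ← h2]; module
  have h4 := (smul_eq_zero.1 h3).resolve_right (h.lightlike x).1
  constructor <;> nlinarith [mul_self_nonneg s, mul_self_nonneg t]

theorem isFoliation_second : IsFoliation (secondFoliation g) 2 where
  frame x := by
    refine ⟨univ, isOpen_univ, mem_univ x, ![antiLeeField g, leeField g], fun y _ => ⟨?_, ?_, ?_⟩⟩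
    · intro i
      fin_cases i
      · exact (h.smoothAt_leeField y).cxJ.neg
      · exact h.smoothAt_leeField y
    · convert h.linearIndependent_leeField y using 1
      ext i; fin_cases i <;> rfl
    · unfold secondFoliation
      congr 1
      ext v
      simp [Fin.exists_fin_two, eq_comm]
  involutive _ _ _ hX hY hXP hYP := h.bracket_mem_secondFoliation hX hY hXP hYP

theorem finrank_firstFoliation (x : M) :
    Module.finrank ℝ (firstFoliation g x) = Module.finrank ℝ E - 1 := by
  have h0 : (leeForm g x).toLinearMap ≠ 0 := fun h0 => h.leeForm_ne_zero x
    (ContinuousLinearMap.ext fun v => congrArg (fun L : RT E x →ₗ[ℝ] ℝ => L v) h0)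
  have := Module.Dual.finrank_ker_add_one_of_ne_zero h0
  have e : Module.finrank ℝ (RT E x) = Module.finrank ℝ E := rfl
  change Module.finrank ℝ (LinearMap.ker (leeForm g x).toLinearMap) = _
  omega

theorem isFoliation_first : IsFoliation (firstFoliation g) (Module.finrank ℝ E - 1) where
  frame x := by
    obtain ⟨c, hc⟩ := h.exists_leeForm_ne_zero x
    let b := Module.finBasisOfFinrankEq ℝ (firstFoliation g x) (h.finrank_firstFoliation x)
    have hb : ∀ i, leeForm g x (b i : RT E x) = 0 := fun i => (b i).2
    have hsm : ∀ v : RT E x, ∀ y ∈ (chartAt E x).source,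
        ContMDiffAt 𝓘(ℝ, E) 𝓘(ℝ, ℝ) ∞ (fun y => leeForm g y (ext v y)) y := fun v y hy =>
      h.smoothAt_leeForm (smoothAt_ext_of_mem v hy)
    have hopen : IsOpen ((chartAt E x).source ∩ (fun y => leeForm g y (ext c y)) ⁻¹' {0}ᶜ) :=
      ContinuousOn.isOpen_inter_preimage
        (fun y hy => (hsm c y hy).continuousAt.continuousWithinAt)
        (chartAt E x).open_source isOpen_compl_singleton
    -- Extend a basis of ker ω at `x` with constant coordinates, then project onto ker ω along the
    -- extension of `c`.
    let X : Fin (Module.finrank ℝ E - 1) → VField E M := fun i y =>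
      ext (b i : RT E x) y + (-(leeForm g y (ext (b i : RT E x) y) / leeForm g y (ext c y))) • ext c y
    refine ⟨_, hopen, ⟨mem_chart_source E x, by simpa using hc⟩, X, ?_⟩
    rintro y ⟨hy, hyc⟩
    have hyc : leeForm g y (ext c y) ≠ 0 := hyc
    have hli : LinearIndependent ℝ (fun i => X i y) := by
      rw [Fintype.linearIndependent_iff]
      intro s hs
      have e1 := congrArg (coord x y) hs
      simp only [X, map_sum, map_smul, map_add, map_zero, coord_ext _ hy, smul_add,
        Finset.sum_add_distrib, smul_smul, ← Finset.sum_smul] at e1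
      set r := ∑ i, s i * -(leeForm g y (ext (b i : RT E x) y) / leeForm g y (ext c y))
      -- In the chart at `x` the relation at `y` becomes one between the `b i` and `c` at `x`;
      -- applying ω there removes `c`.
      have e2 : (∑ i, s i • (b i : RT E x)) + r • c = 0 := e1
      have e3 := congrArg (leeForm g x) e2
      simp only [map_sum, map_smul, map_add, map_zero, hb, smul_eq_mul, mul_zero,
        Finset.sum_const_zero, zero_add] at e3
      have e4 : r = 0 := (mul_eq_zero.1 e3).resolve_right hc
      rw [e4, zero_smul, add_zero] at e2
      have e5 : ∑ i, s i • b i = 0 := by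
        apply Subtype.ext
        simpa using e2
      exact Fintype.linearIndependent_iff.1 b.linearIndependent s e5
    refine ⟨fun i => ?_, hli, ?_⟩
    · refine (smoothAt_ext_of_mem _ hy).add (SmoothAt.smul ?_ (smoothAt_ext_of_mem _ hy))
      exact ((hsm _ y hy).div₀ (hsm c y hy) hyc).neg
    · refine Submodule.eq_of_le_of_finrank_eq ?_ ?_
      · rw [Submodule.span_le]
        rintro _ ⟨i, rfl⟩
        change leeForm g y (X i y) = 0
        simp only [X, map_add, map_smul, smul_eq_mul]
        field_simp
        ring
      · rw [finrank_span_eq_card hli, h.finrank_firstFoliation, Fintype.card_fin]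
  involutive x X Y hX hY hXD hYD := by
    change leeForm g x _ = 0
    have hX0 : ∀ᶠ y in 𝓝 x, leeForm g y (X y) = 0 := hXD.mono fun y hy => hy
    have hY0 : ∀ᶠ y in 𝓝 x, leeForm g y (Y y) = 0 := hYD.mono fun y hy => hy
    rw [h.leeForm_bracket hX hY, dirDeriv_eq_zero hX0, dirDeriv_eq_zero hY0, sub_zero]

theorem secondFoliation_le (x : M) : secondFoliation g x ≤ firstFoliation g x := by
  intro v hv
  obtain ⟨a, b, rfl⟩ := mem_secondFoliation.1 hv
  change leeForm g x _ = 0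
  rw [map_add, map_smul, map_smul, h.leeForm_leeField, h.leeForm_cxJ_leeField, smul_zero, smul_zero,
    add_zero]

theorem isSubfoliation : IsSubfoliation (secondFoliation g) (firstFoliation g) where
  foliation := ⟨_, h.isFoliation_second⟩
  foliation' := ⟨_, h.isFoliation_first⟩
  tangent_le := h.secondFoliation_le
  leaf_subset := leaf_mono h.secondFoliation_le

/-- In complex dimension two the second canonical foliation is the Levi distribution. -/
theorem secondFoliation_eq_leviDist (hn : Module.finrank ℂ E = 2) (x : M) :
    secondFoliation g x = leviDist (firstFoliation g) x := by
  have hle : secondFoliation g x ≤ leviDist (firstFoliation g) x := by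
    intro v hv
    refine ⟨h.secondFoliation_le x hv, h.secondFoliation_le x ?_⟩
    obtain ⟨a, b, rfl⟩ := mem_secondFoliation.1 hv
    exact mem_secondFoliation.2 ⟨-b, a, by simp; abel⟩
  refine Submodule.eq_of_le_of_finrank_le hle ?_
  have h2 : Module.finrank ℝ (secondFoliation g x) = 2 := by
    have := finrank_span_eq_card (h.linearIndependent_leeField x)
    rw [Fintype.card_fin, Matrix.range_cons, Matrix.range_cons, Matrix.range_empty,
      Set.union_empty, Set.singleton_union] at this
    exact this
  have h4 : Module.finrank ℝ (RT E x) = 4 := by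
    change Module.finrank ℝ E = 4
    rw [← Module.finrank_mul_finrank ℝ ℂ E, hn, Complex.finrank_real_complex]
  obtain ⟨c, hc⟩ := h.exists_leeForm_ne_zero x
  -- The Levi distribution is the kernel of (ω, ω∘J). Surjectivity onto ℝ², checked on combinations
  -- of `c` and `Jc`, gives it real dimension 4 - 2 = 2.
  let L : RT E x →ₗ[ℝ] ℝ × ℝ :=
    (leeForm g x).toLinearMap.prod ((leeForm g x).toLinearMap.comp (cxJ x).toLinearMap)
  have hker : leviDist (firstFoliation g) x = LinearMap.ker L := by
    ext v
    simp only [L, LinearMap.ker_prod]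
    rfl
  have hsurj : Function.Surjective L := by
    rintro ⟨a, b⟩
    set p := leeForm g x c
    set q := leeForm g x (cxJ x c)
    have hd : p * p + q * q ≠ 0 :=
      (add_pos_of_pos_of_nonneg (mul_self_pos.2 hc) (mul_self_nonneg _)).ne'
    refine ⟨((a * p + b * q) / (p * p + q * q)) • c
      + ((a * q - b * p) / (p * p + q * q)) • cxJ x c, ?_⟩
    refine Prod.ext ?_ ?_
    · change leeForm g x _ = a
      rw [map_add, map_smul, map_smul]
      change _ * p + _ * q = a
      field_simp
      ring
    · change leeForm g x (cxJ x _) = b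
      rw [map_add, map_smul, map_smul, map_add, map_smul, map_smul, cxJ_cxJ, map_neg]
      change _ * q + _ * -p = b
      field_simp
      ring
  have hrk := L.finrank_range_add_finrank_ker
  rw [LinearMap.range_eq_top.2 hsurj, finrank_top, Module.finrank_prod, Module.finrank_self, h4,
    ← hker] at hrk
  omega

end IsLightlikeParallelLCK

end IndefLCK

/-! ### Holomorphy of the Lee field. -/

namespace IndefLCK

variable {E : Type*} [NormedAddCommGroup E] [NormedSpace ℂ E] [FiniteDimensional ℂ E]
  {M : Type*} [TopologicalSpace M] [ChartedSpace E M] [IsManifold 𝓘(ℂ, E) ω M]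

section Charts

/-- A vector field read in the preferred chart at `x`. -/
noncomputable def inChart (x : M) (X : VField E M) : E → E := fun u =>
  coord x ((chartAt E x).symm u) (X ((chartAt E x).symm u))

theorem inChart_apply {x y : M} (hy : y ∈ (chartAt E x).source) (X : VField E M) :
    inChart x X (chartAt E x y) = coord x y (X y) := by
  unfold inChart
  rw [(chartAt E x).left_inv hy]

theorem inChart_cxJ {x : M} {u : E} (hu : u ∈ (chartAt E x).target) (X : VField E M) :
    inChart x (fun y => cxJ y (X y)) u = Complex.I • inChart x X u :=
  coord_cxJ ((chartAt E x).map_target hu) _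

theorem inChart_ext {x : M} {u : E} (hu : u ∈ (chartAt E x).target) (v : RT E x) :
    inChart x (ext v) u = v :=
  coord_ext v ((chartAt E x).map_target hu)

/-- At the centre of the chart `coord x x` is the identity, so the bracket is the usual one in E.
This turns L_B J = 0 into Cauchy-Riemann equations. -/
theorem bracket_eq_fderiv (V W : VField E M) (x : M) :
    bracket V W x = (fderiv ℝ (inChart x W) (chartAt E x x) (V x : E)
      - fderiv ℝ (inChart x V) (chartAt E x x) (W x : E) : E) := by
  have hx := mem_chart_source E x
  have hxt := mem_chart_target E x
  have hpull : ∀ X : VField E M, VectorField.mpullbackWithin 𝓘(ℝ, E) 𝓘(ℝ, E)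
      (extChartAt 𝓘(ℝ, E) x).symm X (range 𝓘(ℝ, E)) =ᶠ[𝓝 (chartAt E x x)] inChart x X := by
    intro X
    filter_upwards [(chartAt E x).open_target.mem_nhds hxt] with u hu
    have hut : u ∈ (extChartAt 𝓘(ℝ, E) x).target := by simpa using hu
    rw [VectorField.mpullbackWithin_apply,
      ContinuousLinearMap.inverse_eq (mfderivWithin_extChartAt_symm_comp_mfderiv_extChartAt hut)
      (mfderiv_extChartAt_comp_mfderivWithin_extChartAt_symm hut),
      ← TangentBundle.continuousLinearMapAt_trivializationAt
        (x := (extChartAt 𝓘(ℝ, E) x).symm u) (by simpa using (chartAt E x).map_target hu)]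
    rfl
  have hself : mfderiv 𝓘(ℝ, E) 𝓘(ℝ, E) (extChartAt 𝓘(ℝ, E) x) x = coord x x :=
    (TangentBundle.continuousLinearMapAt_trivializationAt hx).symm
  have hid : (coord x x : RT E x →L[ℝ] E) = ContinuousLinearMap.id ℝ E :=
    ContinuousLinearMap.ext fun v => coord_self x v
  have hself' : mfderiv 𝓘(ℝ, E) 𝓘(ℝ, E) (extChartAt 𝓘(ℝ, E) x) x = ContinuousLinearMap.id ℝ E :=
    hself.trans hid
  obtain ⟨L, V', W', s, hL, hV, hW, hs, h1⟩ : ∃ (L : E →L[ℝ] E) (V' W' : E → E) (s : Set E),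
      L = ContinuousLinearMap.id ℝ E ∧ V' =ᶠ[𝓝 (chartAt E x x)] inChart x V ∧
      W' =ᶠ[𝓝 (chartAt E x x)] inChart x W ∧ s = univ ∧
      bracket V W x = L.inverse (VectorField.lieBracketWithin ℝ V' W' s (chartAt E x x)) :=
    ⟨_, _, _, (extChartAt 𝓘(ℝ, E) x).symm ⁻¹' univ ∩ range 𝓘(ℝ, E), hself', hpull V, hpull W,
      by simp, rfl⟩
  rw [h1, hs, VectorField.lieBracketWithin_univ, hV.lieBracket_vectorField_eq hW, hL,
    ContinuousLinearMap.inverse_id]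
  have e : ∀ X : VField E M, inChart x X (chartAt E x x) = X x := fun X => by
    rw [inChart_apply hx, coord_self]
  change fderiv ℝ (inChart x W) (chartAt E x x) (inChart x V (chartAt E x x))
    - fderiv ℝ (inChart x V) (chartAt E x x) (inChart x W (chartAt E x x)) = _
  rw [e, e]

theorem contDiffAt_inChart {X : VField E M} {x y : M} (hy : y ∈ (chartAt E x).source)
    (hX : SmoothAt X y) : ContDiffAt ℝ ∞ (inChart x X) (chartAt E x y) := by
  rw [← contMDiffAt_iff_contDiffAt]
  have hs : ContMDiffAt 𝓘(ℝ, E) 𝓘(ℝ, E) ∞ (chartAt E x).symm (chartAt E x y) :=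
    (contMDiffOn_chart_symm (I := 𝓘(ℝ, E)) (n := ∞) (x := x)).contMDiffAt
      ((chartAt E x).open_target.mem_nhds ((chartAt E x).map_source hy))
  have h1 : ContMDiffAt 𝓘(ℝ, E) 𝓘(ℝ, E) ∞ (fun z => coord x z (X z)) y := by
    unfold SmoothAt at hX
    rw [Bundle.Trivialization.contMDiffAt_section_iff
      (e := trivializationAt E (TangentSpace 𝓘(ℝ, E)) x) ((mem_baseSet x y).2 hy)] at hX
    refine hX.congr_of_eventuallyEq ?_
    filter_upwards [(chartAt E x).open_source.mem_nhds hy] with z hz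
    rw [coord_eq_trivialization hz]
  have h2 : ContMDiffAt 𝓘(ℝ, E) 𝓘(ℝ, E) ∞ (fun z => coord x z (X z))
      ((chartAt E x).symm (chartAt E x y)) := by rwa [(chartAt E x).left_inv hy]
  exact h2.comp _ hs

/-- A vector field is holomorphic at `y` if and only if it is so in the preferred chart at `x`. -/
theorem contMDiffAt_iff_inChart {X : VField E M} {x y : M} (hy : y ∈ (chartAt E x).source) :
    ContMDiffAt 𝓘(ℂ, E) (𝓘(ℂ, E).prod 𝓘(ℂ, E)) ω
      (fun z => (⟨z, X z⟩ : TangentBundle 𝓘(ℂ, E) M)) y ↔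
    ContDiffAt ℂ ω (inChart x X) (chartAt E x y) := by
  have hbase : y ∈ (trivializationAt E (TangentSpace 𝓘(ℂ, E)) x).baseSet := hy
  have hs : ContMDiffAt 𝓘(ℂ, E) 𝓘(ℂ, E) ω (chartAt E x).symm (chartAt E x y) :=
    (contMDiffOn_chart_symm (I := 𝓘(ℂ, E)) (n := ω) (x := x)).contMDiffAt
      ((chartAt E x).open_target.mem_nhds ((chartAt E x).map_source hy))
  have hc : ContMDiffAt 𝓘(ℂ, E) 𝓘(ℂ, E) ω (chartAt E x) y :=
    (contMDiffOn_chart (I := 𝓘(ℂ, E)) (n := ω) (x := x)).contMDiffAt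
      ((chartAt E x).open_source.mem_nhds hy)
  have he : (fun z => (trivializationAt E (TangentSpace 𝓘(ℂ, E)) x
      ⟨z, (X z : TangentSpace 𝓘(ℂ, E) z)⟩).2) =ᶠ[𝓝 y] fun z => coord x z (X z) := by
    filter_upwards [(chartAt E x).open_source.mem_nhds hy] with z hz
    rw [coord_eq_complex_trivialization hz]
  refine (Bundle.Trivialization.contMDiffAt_section_iff
      (e := trivializationAt E (TangentSpace 𝓘(ℂ, E)) x) hbase).trans ?_
  rw [he.contMDiffAt_iff, ← contMDiffAt_iff_contDiffAt]
  constructor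
  · intro h1
    have h2 : ContMDiffAt 𝓘(ℂ, E) 𝓘(ℂ, E) ω (fun z => coord x z (X z))
        ((chartAt E x).symm (chartAt E x y)) := by rwa [(chartAt E x).left_inv hy]
    exact h2.comp _ hs
  · intro h1
    refine (h1.comp _ hc).congr_of_eventuallyEq ?_
    filter_upwards [(chartAt E x).open_source.mem_nhds hy] with z hz
    exact (inChart_apply hz X).symm

/-- Complex differentiability of a vector field at a point does not depend on the chart. -/
theorem mdifferentiableAt_iff_inChart {X : VField E M} {x y : M} (hy : y ∈ (chartAt E x).source) :
    MDifferentiableAt 𝓘(ℂ, E) (𝓘(ℂ, E).prod 𝓘(ℂ, E))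
      (fun z => (⟨z, X z⟩ : TangentBundle 𝓘(ℂ, E) M)) y ↔
    DifferentiableAt ℂ (inChart x X) (chartAt E x y) := by
  have hbase : y ∈ (trivializationAt E (TangentSpace 𝓘(ℂ, E)) x).baseSet := hy
  have hs : MDifferentiableAt 𝓘(ℂ, E) 𝓘(ℂ, E) (chartAt E x).symm (chartAt E x y) :=
    mdifferentiableAt_atlas_symm (chart_mem_atlas E x) ((chartAt E x).map_source hy)
  have hc : MDifferentiableAt 𝓘(ℂ, E) 𝓘(ℂ, E) (chartAt E x) y :=
    mdifferentiableAt_atlas (chart_mem_atlas E x) hy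
  have he : (fun z => (trivializationAt E (TangentSpace 𝓘(ℂ, E)) x
      ⟨z, (X z : TangentSpace 𝓘(ℂ, E) z)⟩).2) =ᶠ[𝓝 y] fun z => coord x z (X z) := by
    filter_upwards [(chartAt E x).open_source.mem_nhds hy] with z hz
    rw [coord_eq_complex_trivialization hz]
  refine (Bundle.Trivialization.mdifferentiableAt_section_iff 𝓘(ℂ, E)
      (trivializationAt E (TangentSpace 𝓘(ℂ, E)) x)
      (fun z => (X z : TangentSpace 𝓘(ℂ, E) z)) hbase).trans ?_
  rw [he.mdifferentiableAt_iff, ← mdifferentiableAt_iff_differentiableAt]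
  constructor
  · intro h1
    have h2 : MDifferentiableAt 𝓘(ℂ, E) 𝓘(ℂ, E) (fun z => coord x z (X z))
        ((chartAt E x).symm (chartAt E x y)) := by rwa [(chartAt E x).left_inv hy]
    exact h2.comp _ hs
  · intro h1
    refine (h1.comp _ hc).congr_of_eventuallyEq ?_
    filter_upwards [(chartAt E x).open_source.mem_nhds hy] with z hz
    exact (inChart_apply hz X).symm

end Charts

theorem mem_span_range_const {b v : E} :
    v ∈ Submodule.span ℂ (range fun _ : Fin 1 => b) ↔
      ∃ s t : ℝ, s • b + t • (Complex.I • b) = v := by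
  rw [range_const, Submodule.mem_span_singleton]
  constructor
  · rintro ⟨c, rfl⟩
    refine ⟨c.re, c.im, ?_⟩
    conv_rhs => rw [← Complex.re_add_im c]
    rw [add_smul, mul_smul, Complex.coe_smul, Complex.coe_smul]
  · rintro ⟨s, t, rfl⟩
    refine ⟨s + t * Complex.I, ?_⟩
    rw [add_smul, mul_smul, Complex.coe_smul, Complex.coe_smul]

namespace IsLightlikeParallelLCK

variable {g : BilinField E M} {ν : ℕ} {x : M} (h : IsLightlikeParallelLCK g ν)

include h

/-- The Lee field is an infinitesimal automorphism of the complex structure. -/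
theorem bracket_leeField_cxJ {X : VField E M} (hX : SmoothAt X x) :
    bracket (leeField g) (fun y => cxJ y (X y)) x = cxJ x (bracket (leeField g) X x) := by
  have hB := h.smoothAt_leeField x
  have hm := h.hermitian.isMetricAt x
  rw [leviCivita_torsion hm hB.diffAt hX.cxJ.diffAt, leviCivita_torsion hm hB.diffAt hX.diffAt,
    h.leviCivita_leeField hX.cxJ, h.leviCivita_leeField hX, sub_zero, sub_zero, ← sub_eq_zero]
  refine h.hermitian.nondegenerate x _ fun z => ?_
  have h1 := h.leviCivita_cxJ hB hX z
  have hBz : ∀ z, g x (leeField g x) z = leeForm g x z := fun z => by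
    rw [h.hermitian.symm, leeField_spec h.hermitian]
  -- With `X = B` every factor g(B, ·) is ω, and the right side cancels in pairs: ∇_B J = 0.
  rw [hBz, hBz, hBz, hBz] at h1
  rw [map_sub, sub_apply, h.hermitian.cxJ_left]
  linarith

/-- The bracket of B with a constant field `w` is `-DB(w)`; comparing `w = v` with `w = i v` shows
that `DB` commutes with `i`. -/
theorem differentiableAt_inChart_leeField_self (x : M) :
    DifferentiableAt ℂ (inChart x (leeField g)) (chartAt E x x) := by
  have hx := mem_chart_source E x
  have hd : DifferentiableAt ℝ (inChart x (leeField g)) (chartAt E x x) :=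
    (contDiffAt_inChart hx (h.smoothAt_leeField x)).differentiableAt (by simp)
  refine differentiableAt_complex_of_real hd fun v => ?_
  have hc : ∀ (X : VField E M) (w : E), (∀ u ∈ (chartAt E x).target, inChart x X u = w) →
      bracket (leeField g) X x
        = (-fderiv ℝ (inChart x (leeField g)) (chartAt E x x) w : E) := by
    intro X w hXw
    have e : inChart x X =ᶠ[𝓝 (chartAt E x x)] fun _ => w := by
      filter_upwards [(chartAt E x).open_target.mem_nhds (mem_chart_target E x)] with u hu
        using hXw u hu
    have e2 : (X x : E) = w := by
      rw [← hXw _ (mem_chart_target E x), inChart_apply hx, coord_self]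
    rw [bracket_eq_fderiv, e.fderiv_eq, fderiv_fun_const, e2]
    exact zero_sub (fderiv ℝ (inChart x (leeField g)) (chartAt E x x) w)
  have h1 := h.bracket_leeField_cxJ (smoothAt_ext (x := x) v)
  rw [hc (ext (x := x) v) v fun u hu => inChart_ext hu v,
    hc (fun y => cxJ y (ext (x := x) v y)) (Complex.I • v) fun u hu => by
      rw [inChart_cxJ hu]; exact congrArg (Complex.I • ·) (inChart_ext hu v)] at h1
  have h2 : -fderiv ℝ (inChart x (leeField g)) (chartAt E x x) (Complex.I • v)
    = Complex.I • -fderiv ℝ (inChart x (leeField g)) (chartAt E x x) v := h1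
  rw [smul_neg, neg_inj] at h2
  exact h2

/-- Holomorphy, known at each point in its own preferred chart, is transferred to one fixed chart; a
real smooth holomorphic map is then analytic. -/
theorem contDiffAt_inChart_leeField {x y : M} (hy : y ∈ (chartAt E x).source) :
    ContDiffAt ℂ ω (inChart x (leeField g)) (chartAt E x y) := by
  have : CompleteSpace E := FiniteDimensional.complete ℂ E
  have hd : DifferentiableOn ℂ (inChart x (leeField g)) (chartAt E x).target := by
    intro u hu
    have hu' := (chartAt E x).map_target hu
    have h1 := (mdifferentiableAt_iff_inChart hu').1
      ((mdifferentiableAt_iff_inChart (mem_chart_source E _)).2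
        (h.differentiableAt_inChart_leeField_self ((chartAt E x).symm u)))
    rw [(chartAt E x).right_inv hu] at h1
    exact h1.differentiableWithinAt
  have hs : ContDiffOn ℝ ∞ (inChart x (leeField g)) (chartAt E x).target := by
    intro u hu
    have h1 := contDiffAt_inChart ((chartAt E x).map_target hu)
      (h.smoothAt_leeField ((chartAt E x).symm u))
    rw [(chartAt E x).right_inv hu] at h1
    exact h1.contDiffWithinAt
  have hC : ContDiffOn ℂ ∞ (inChart x (leeField g)) (chartAt E x).target :=
    contDiffOn_infty.2 fun n =>
      contDiffOn_complex_of_real (chartAt E x).open_target n _ hs hd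
  exact (analyticAt_of_contDiffOn (chartAt E x).open_target hC
    ((chartAt E x).map_source hy)).contDiffAt

/-- The Lee field is a nowhere zero holomorphic frame whose complex line is spanned over ℝ by B and
JB. -/
theorem isHolomorphicFoliation_second : IsHolomorphicFoliation (secondFoliation g) 1 where
  frame x := by
    refine ⟨univ, isOpen_univ, mem_univ x, fun _ y => leeField g y, fun _ y _ => ?_, fun y _ => ⟨?_, ?_⟩⟩
    · exact ((contMDiffAt_iff_inChart (mem_chart_source E y)).2
        (h.contDiffAt_inChart_leeField (mem_chart_source E y))).contMDiffWithinAt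
    · exact LinearIndependent.of_subsingleton (0 : Fin 1) (h.lightlike y).1
    · intro v
      exact (mem_span_range_const (E := E)).trans mem_secondFoliation.symm
  involutive _ _ _ hX hY hXP hYP := h.bracket_mem_secondFoliation hX hY hXP hYP

end IsLightlikeParallelLCK

end IndefLCK

/-! ### Holomorphic maps vanishing on a leaf. -/

namespace IndefLCK

section LevelSets

/-- Through a regular point of a smooth function there is, in each direction tangent to the level
set, a smooth curve in the level set. -/
theorem exists_curve_in_level_set {E : Type*} [NormedAddCommGroup E] [NormedSpace ℝ E]
    [CompleteSpace E] {F : E → ℝ} {V : Set E} (hV : IsOpen V) (hF : ContDiffOn ℝ ∞ F V) {u v : E}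
    (hu : u ∈ V) (hne : fderiv ℝ F u ≠ 0) (hv : fderiv ℝ F u v = 0) :
    ∃ (c : ℝ → E) (ε : ℝ), ε ≠ 0 ∧ ContDiff ℝ ∞ c ∧ c 0 = u ∧ HasDerivAt c (ε • v) 0 ∧
      ∀ t, c t ∈ V ∧ F (c t) = F u := by
  set L := fderiv ℝ F u with hL
  obtain ⟨b, hb⟩ : ∃ b, L b ≠ 0 := by
    by_contra! hb
    exact hne (ContinuousLinearMap.ext hb)
  obtain ⟨C, hC⟩ : ∃ C, L C = 1 := ⟨(L b)⁻¹ • b, by rw [map_smul, smul_eq_mul, inv_mul_cancel₀ hb]⟩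
  -- `Ψ` straightens the level sets: `L (Ψ e) = F e - F u + L u`, and its derivative at `u` is the
  -- identity.
  let Ψ : E → E := fun e => e + (F e - F u - L (e - u)) • C
  have hΨu : Ψ u = u := by simp [Ψ]
  have hFV : ∀ e ∈ V, ContDiffAt ℝ ∞ F e := fun e he => hF.contDiffAt (hV.mem_nhds he)
  have hΨ : ∀ e ∈ V, ContDiffAt ℝ ∞ Ψ e := fun e he =>
    contDiffAt_id.add ((((hFV e he).sub contDiffAt_const).sub
      (L.contDiff.contDiffAt.comp e (contDiffAt_id.sub contDiffAt_const))).smul contDiffAt_const)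
  have hΨd : HasFDerivAt Ψ ((ContinuousLinearEquiv.refl ℝ E : E ≃L[ℝ] E) : E →L[ℝ] E) u := by
    have h1 : HasFDerivAt F L u := ((hFV u hu).differentiableAt (by simp)).hasFDerivAt
    have h2 : HasFDerivAt (fun e => L (e - u)) L u :=
      L.hasFDerivAt.comp u ((hasFDerivAt_id u).sub_const u)
    have h3 := (hasFDerivAt_id (𝕜 := ℝ) u).add (((h1.sub_const (F u)).sub h2).smul_const C)
    refine h3.congr_fderiv ?_
    ext e
    simp
  let Φ := (hΨ u hu).toOpenPartialHomeomorph Ψ hΨd (by simp)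
  have hΦ : ∀ e, Φ e = Ψ e := fun e => rfl
  have hus : u ∈ Φ.source := (hΨ u hu).mem_toOpenPartialHomeomorph_source hΨd (by simp)
  have hut : u ∈ Φ.target := by
    have := Φ.map_source hus
    rwa [hΦ, hΨu] at this
  have hsu : Φ.symm u = u := by
    have := Φ.left_inv hus
    rwa [hΦ, hΨu] at this
  have hinv : ∀ᶠ e in 𝓝 u, fderiv ℝ Ψ e ∈ range ((↑) : (E ≃L[ℝ] E) → E →L[ℝ] E) := by
    have hc : ContinuousAt (fderiv ℝ Ψ) u :=
      ((hΨ u hu).fderiv_right (m := 0) (by simp)).continuousAt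
    refine hc ?_
    rw [hΨd.fderiv]
    exact ContinuousLinearEquiv.nhds _
  have hsc : Filter.Tendsto Φ.symm (𝓝 u) (𝓝 u) := by
    have := Φ.symm.continuousAt (x := u) hut
    rwa [ContinuousAt, hsu] at this
  have hev : ∀ᶠ w in 𝓝 u, w ∈ Φ.target ∧ Φ.symm w ∈ V ∧
      fderiv ℝ Ψ (Φ.symm w) ∈ range ((↑) : (E ≃L[ℝ] E) → E →L[ℝ] E) :=
    Filter.Eventually.and (IsOpen.mem_nhds Φ.open_target hut)
      (Filter.Eventually.and (hsc (hV.mem_nhds hu)) (hsc hinv))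
  obtain ⟨δ, hδ, hball⟩ := Metric.eventually_nhds_iff.1 hev
  set ε : ℝ := δ / (2 * (‖v‖ + 1)) with hε
  have hvpos : 0 < ‖v‖ + 1 := by positivity
  have hεpos : 0 < ε := by positivity
  -- The sine keeps the segment inside the ball for all real `t`, so the curve is defined on the
  -- whole line, as `TangentJoined` demands.
  let l : ℝ → E := fun t => u + (ε * Real.sin t) • v
  have hl : ∀ t, dist (l t) u < δ := by
    intro t
    rw [dist_eq_norm]
    simp only [l, add_sub_cancel_left, norm_smul, Real.norm_eq_abs, abs_mul, abs_of_pos hεpos]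
    calc ε * |Real.sin t| * ‖v‖ ≤ ε * 1 * (‖v‖ + 1) := by
          gcongr
          · exact Real.abs_sin_le_one t
          · linarith
      _ = δ / 2 := by rw [hε]; field_simp
      _ < δ := by linarith
  have hlc : ContDiff ℝ ∞ l := contDiff_const.add
    ((contDiff_const.mul Real.contDiff_sin).smul contDiff_const)
  have hl0 : l 0 = u := by simp [l]
  refine ⟨fun t => Φ.symm (l t), ε, hεpos.ne', ?_, by simp [hl0, hsu], ?_, fun t => ?_⟩
  · rw [contDiff_iff_contDiffAt]
    intro t
    obtain ⟨h1, h2, e, he⟩ := hball (hl t)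
    have h3 : ContDiffAt ℝ ∞ Φ.symm (l t) := by
      refine Φ.contDiffAt_symm (f₀' := e) h1 ?_ (hΨ _ h2)
      rw [he]
      exact ((hΨ _ h2).differentiableAt (by simp)).hasFDerivAt
    exact h3.comp t hlc.contDiffAt
  · have h1 : HasFDerivAt Φ.symm
        (((ContinuousLinearEquiv.refl ℝ E).symm : E ≃L[ℝ] E) : E →L[ℝ] E) (l 0) := by
      rw [hl0]
      refine Φ.hasFDerivAt_symm hut ?_
      rw [hsu]
      exact hΨd
    have h2 : HasDerivAt l (ε • v) 0 := by
      have h3 := ((Real.hasDerivAt_sin 0).const_mul ε).smul_const v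
      rw [Real.cos_zero, mul_one] at h3
      exact h3.const_add u
    exact h1.comp_hasDerivAt 0 h2
  · obtain ⟨h1, h2, -⟩ := hball (hl t)
    refine ⟨h2, ?_⟩
    have h3 := Φ.right_inv h1
    rw [hΦ] at h3
    -- Since `L v = 0`, `L` is constant along `l`, hence `F` is constant along the curve.
    have h4 := congrArg L h3
    simp only [Ψ, l, map_add, map_smul, map_sub, hC, hv, smul_eq_mul] at h4
    linarith

/-- An analytic function vanishes near a point where all its derivatives vanish. -/
theorem eventually_eq_zero_of_iteratedFDeriv {E F : Type*} [NormedAddCommGroup E] [NormedSpace ℂ E]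
    [NormedAddCommGroup F] [NormedSpace ℂ F] [CompleteSpace F] {ψ : E → F} {u : E}
    (hψ : AnalyticAt ℂ ψ u) (h0 : ∀ n, iteratedFDeriv ℂ n ψ u = 0) : ∀ᶠ w in 𝓝 u, ψ w = 0 := by
  obtain ⟨p, r, hp⟩ := hψ
  filter_upwards [Metric.eball_mem_nhds u hp.r_pos] with w hw
  have hw' : w - u ∈ Metric.eball (0 : E) r := by
    simpa [edist_eq_enorm_sub] using hw
  have h1 := hp.hasSum_iteratedFDeriv hw'
  simp only [h0, zero_apply, smul_zero, add_sub_cancel] at h1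
  exact h1.unique hasSum_zero

end LevelSets

variable {E : Type*} [NormedAddCommGroup E] [NormedSpace ℂ E] [FiniteDimensional ℂ E]
  {M : Type*} [TopologicalSpace M] [ChartedSpace E M] [IsManifold 𝓘(ℂ, E) ω M]

namespace IsLightlikeParallelLCK

variable {g : BilinField E M} {ν : ℕ} {x : M} (h : IsLightlikeParallelLCK g ν)

include h

/-- Locally ω = df, so a curve in a level set of `f` is tangent to ker ω and stays in the leaf. -/
theorem exists_curve_in_leaf {x y : M} (hy : y ∈ (chartAt E x).source) {v : RT E y}
    (hv : leeForm g y v = 0) :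
    ∃ (c : ℝ → E) (ε : ℝ), ε ≠ 0 ∧ c 0 = chartAt E x y ∧ HasDerivAt c (ε • coord x y v) 0 ∧
      ∀ t, c t ∈ (chartAt E x).target ∧
        (chartAt E x).symm (c t) ∈ leaf (firstFoliation g) y := by
  have : CompleteSpace E := FiniteDimensional.complete ℂ E
  obtain ⟨U, f, hyU, hU, hf, hfe⟩ := h.exists_potential y
  set φ := chartAt E x with hφ
  have hfd : ∀ z ∈ U, MDifferentiableAt 𝓘(ℝ, E) 𝓘(ℝ, ℝ) f z := fun z hz =>
    (hf.contMDiffAt (hU.mem_nhds hz)).mdifferentiableAt (by simp)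
  have hV : IsOpen (φ.target ∩ φ.symm ⁻¹' U) := φ.isOpen_inter_preimage_symm hU
  have hFV : ContDiffOn ℝ ∞ (f ∘ φ.symm) (φ.target ∩ φ.symm ⁻¹' U) := by
    rintro u ⟨hu, huU⟩
    have h1 := contDiffAt_comp_chart_symm (φ.map_target hu) (hf.contMDiffAt (hU.mem_nhds huU))
    rw [φ.right_inv hu] at h1
    exact h1.contDiffWithinAt
  have hyV : φ y ∈ φ.target ∩ φ.symm ⁻¹' U :=
    ⟨φ.map_source hy, by rwa [mem_preimage, φ.left_inv hy]⟩
  have hder : ∀ w : RT E y, fderiv ℝ (f ∘ φ.symm) (φ y) (coord x y w) = leeForm g y w := fun w => by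
    rw [hfe y hyU, dirDeriv_eq_fderiv hy (hfd y hyU)]
  have hne : fderiv ℝ (f ∘ φ.symm) (φ y) ≠ 0 := fun h0 => by
    obtain ⟨w, hw⟩ := h.exists_leeForm_ne_zero y
    rw [← hder, h0] at hw
    exact hw rfl
  obtain ⟨c, ε, hε, hc, hc0, hcd, hcV⟩ :=
    exists_curve_in_level_set hV hFV hyV hne ((hder v).trans hv)
  refine ⟨c, ε, hε, hc0, hcd, fun t => ⟨(hcV t).1.1, Relation.EqvGen.rel _ _ ?_⟩⟩
  have hγ : ContMDiff 𝓘(ℝ, ℝ) 𝓘(ℝ, E) ∞ (fun s : ℝ => φ.symm (c (t * s))) := by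
    intro s
    have h1 : ContMDiffAt 𝓘(ℝ, E) 𝓘(ℝ, E) ∞ φ.symm (c (t * s)) :=
      (contMDiffOn_chart_symm (I := 𝓘(ℝ, E)) (n := ∞) (x := x)).contMDiffAt
        (φ.open_target.mem_nhds (hcV _).1.1)
    have h2 : ContMDiffAt 𝓘(ℝ, ℝ) 𝓘(ℝ, E) ∞ (fun s : ℝ => c (t * s)) s :=
      (hc.comp (contDiff_const.mul contDiff_id)).contMDiff.contMDiffAt
    exact h1.comp s h2
  -- The rescaled curve runs from `y` at time 0 to the point of parameter `t` at time 1.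
  refine ⟨fun s => φ.symm (c (t * s)), hγ, ?_, by simp, fun s => ?_⟩
  · simp only [mul_zero, hc0]
    exact φ.left_inv hy
  · change leeForm g _ _ = 0
    have hs : φ.symm (c (t * s)) ∈ U := (hcV _).1.2
    rw [hfe _ hs]
    have h1 : mfderiv 𝓘(ℝ, ℝ) 𝓘(ℝ, ℝ) (f ∘ fun s : ℝ => φ.symm (c (t * s))) s = _ :=
      mfderiv_comp s (hfd _ hs) ((hγ s).mdifferentiableAt (by simp))
    have h2 : (f ∘ fun s : ℝ => φ.symm (c (t * s))) = fun _ => (f ∘ φ.symm) (φ y) := by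
      funext s
      exact (hcV _).2
    rw [h2, mfderiv_const] at h1
    exact (congrArg (fun A : ℝ →L[ℝ] ℝ => A 1) h1).symm

/-- If a map that is holomorphic near a point vanishes on the leaf of the first canonical foliation
through it, then so does its derivative. -/
theorem fderiv_eq_zero_of_leaf {F : Type*} [NormedAddCommGroup F] [NormedSpace ℂ F] {x y : M}
    (hy : y ∈ (chartAt E x).source) {ψ : E → F} {W : Set E} (hW : W ∈ 𝓝 (chartAt E x y))
    (hψ : DifferentiableAt ℂ ψ (chartAt E x y))
    (h0 : ∀ u ∈ W, u ∈ (chartAt E x).target →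
      (chartAt E x).symm u ∈ leaf (firstFoliation g) y → ψ u = 0) :
    fderiv ℂ ψ (chartAt E x y) = 0 := by
  set D := fderiv ℂ ψ (chartAt E x y)
  have hker : ∀ v : RT E y, leeForm g y v = 0 → D (coord x y v) = 0 := by
    intro v hv
    obtain ⟨c, ε, hε, hc0, hcd, hc⟩ := h.exists_curve_in_leaf hy hv
    have h1 : HasFDerivAt ψ (D.restrictScalars ℝ) (c 0) := by
      rw [hc0]
      exact hψ.hasFDerivAt.restrictScalars ℝ
    have h2 := h1.comp_hasDerivAt 0 hcd
    have h3 : (ψ ∘ c) =ᶠ[𝓝 0] fun _ => 0 := by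
      have hcW : ∀ᶠ t in 𝓝 (0 : ℝ), c t ∈ W := hcd.continuousAt (by rwa [hc0])
      filter_upwards [hcW] with t ht using h0 _ ht (hc t).1 (hc t).2
    have h4 := h2.unique ((hasDerivAt_const (0 : ℝ) (0 : F)).congr_of_eventuallyEq h3)
    rw [map_smul] at h4
    exact (smul_eq_zero.1 h4).resolve_left hε
  obtain ⟨b, hb⟩ := h.exists_leeForm_ne_zero y
  set p := leeForm g y b with hp
  set q := leeForm g y (cxJ y b) with hq
  -- `b₀` lies in ker ω and ω(J b₀) = -(p² + q²) is nonzero, so ker ω and `J b₀` span the tangent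
  -- space. `D` vanishes on both, being complex linear.
  set b₀ : RT E y := p • cxJ y b - q • b with hb₀
  have hJb₀ : cxJ y b₀ = -(p • b) - q • cxJ y b := by
    rw [hb₀, map_sub, map_smul, map_smul, cxJ_cxJ, smul_neg]
  have e0 : leeForm g y b₀ = 0 := by
    rw [hb₀, map_sub, map_smul, map_smul, ← hp, ← hq, smul_eq_mul, smul_eq_mul]; ring
  have e1 : leeForm g y (cxJ y b₀) = -(p * p + q * q) := by
    rw [hJb₀, map_sub, map_neg, map_smul, map_smul, ← hp, ← hq, smul_eq_mul, smul_eq_mul]; ring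
  have hd : p * p + q * q ≠ 0 :=
    (add_pos_of_pos_of_nonneg (mul_self_pos.2 hb) (mul_self_nonneg _)).ne'
  ext w
  obtain ⟨v, rfl⟩ := coord_surjective hy w
  set r := leeForm g y v / (p * p + q * q) with hr
  have h1 := hker (v + r • cxJ y b₀) (by
    rw [map_add, map_smul, e1, hr, smul_eq_mul]; field_simp; ring)
  have h2 : D (coord x y (cxJ y b₀)) = 0 := by
    rw [coord_cxJ hy, map_smul, hker b₀ e0, smul_zero]
  rw [map_add, map_smul, map_add] at h1
  have h3 : D (r • coord x y (cxJ y b₀)) = r • D (coord x y (cxJ y b₀)) :=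
    (D.restrictScalars ℝ).map_smul r _
  rw [h3, h2, smul_zero, add_zero] at h1
  exact h1

/-- A holomorphic map that vanishes on a leaf of the first canonical foliation vanishes near it. -/
theorem eventually_eq_zero_of_leaf {F : Type*} [NormedAddCommGroup F] [NormedSpace ℂ F]
    [CompleteSpace F] {x y : M} (hy : y ∈ (chartAt E x).source) {ψ : E → F} {W : Set E}
    (hW : IsOpen W) (hyW : chartAt E x y ∈ W) (hψ : AnalyticOnNhd ℂ ψ W)
    (h0 : ∀ u ∈ W, u ∈ (chartAt E x).target →
      (chartAt E x).symm u ∈ leaf (firstFoliation g) y → ψ u = 0) :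
    ∀ᶠ u in 𝓝 (chartAt E x y), ψ u = 0 := by
  -- The induction runs over all nearby leaf points at once: the next derivative at a point needs
  -- the previous one to vanish along the leaf around it.
  have key : ∀ n, ∀ u ∈ W, u ∈ (chartAt E x).target →
      (chartAt E x).symm u ∈ leaf (firstFoliation g) y → iteratedFDeriv ℂ n ψ u = 0 := by
    intro n
    induction n with
    | zero =>
      intro u hu hut hul
      ext
      simp [h0 u hu hut hul]
    | succ n ih =>
      intro u hu hut hul
      have hsrc := (chartAt E x).map_target hut
      have hru := (chartAt E x).right_inv hut
      have h1 := h.fderiv_eq_zero_of_leaf hsrc (ψ := iteratedFDeriv ℂ n ψ) (W := W)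
        (by rw [hru]; exact hW.mem_nhds hu)
        (by rw [hru]; exact (hψ.iteratedFDeriv n u hu).differentiableAt)
        fun w hw hwt hwl => ih w hw hwt (Relation.EqvGen.trans _ _ _ hul hwl)
      rw [hru] at h1
      refine norm_eq_zero.1 (norm_fderiv_iteratedFDeriv.symm.trans ?_)
      exact (congrArg norm h1).trans norm_zero
  refine eventually_eq_zero_of_iteratedFDeriv (hψ _ hyW) fun n =>
    key n _ hyW ((chartAt E x).map_source hy) ?_
  rw [(chartAt E x).left_inv hy]
  exact Relation.EqvGen.refl _

end IsLightlikeParallelLCK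

end IndefLCK

/-! ### Uniqueness of holomorphic foliations by curves. -/

namespace IndefLCK

variable {E : Type*} [NormedAddCommGroup E] [NormedSpace ℂ E] [FiniteDimensional ℂ E]
  {M : Type*} [TopologicalSpace M] [ChartedSpace E M] [IsManifold 𝓘(ℂ, E) ω M]

theorem coord_complex_smul {x y : M} (hy : y ∈ (chartAt E x).source) (c : ℂ) (v : E) :
    coord x y (c • v : E) = c • coord x y (v : RT E y) := by
  refine (coord_eq_complex hy _).trans ?_
  exact ((fderiv ℂ (chartAt E x ∘ (chartAt E y).symm) (chartAt E y y)).map_smul c v).trans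
    (congrArg (c • ·) (coord_eq_complex hy _).symm)

namespace IsHolomorphicFoliation

variable {G G' : Distribution E M}

/-- A holomorphic foliation by curves is locally spanned by a holomorphic vector field. -/
theorem exists_generator (hG : IsHolomorphicFoliation G 1) (x : M) :
    ∃ (U : Set M) (X : VField E M), IsOpen U ∧ x ∈ U ∧
      (∀ y ∈ U, ContMDiffAt 𝓘(ℂ, E) (𝓘(ℂ, E).prod 𝓘(ℂ, E)) ω
        (fun z => (⟨z, X z⟩ : TangentBundle 𝓘(ℂ, E) M)) y) ∧
      ∀ y ∈ U, ∃ a : E, X y = a ∧ a ≠ 0 ∧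
        ∀ v : E, v ∈ Submodule.span ℂ {a} ↔ (v : RT E y) ∈ G y := by
  obtain ⟨U, hU, hxU, X, hX, hspan⟩ := hG.frame x
  refine ⟨U, X 0, hU, hxU, fun y hy => (hX 0).contMDiffAt (hU.mem_nhds hy), fun y hy =>
    ⟨X 0 y, rfl, (hspan y hy).1.ne_zero 0, fun v => ?_⟩⟩
  have h1 := (hspan y hy).2 v
  have h2 : (range fun i => X i y) = {X 0 y} := by
    ext w
    simp [Fin.exists_fin_one, eq_comm]
  rw [h2] at h1
  exact h1

/-- The rank of a holomorphic foliation is determined by any of its tangent spaces. -/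
theorem rank_eq {k l : ℕ} (hG : IsHolomorphicFoliation G k) (hG' : IsHolomorphicFoliation G' l)
    {x : M} (hx : G x = G' x) : k = l := by
  obtain ⟨U, -, hxU, X, -, hX⟩ := hG.frame x
  obtain ⟨U', -, hxU', X', -, hX'⟩ := hG'.frame x
  have h1 : Submodule.span ℂ (range fun i => X i x) = Submodule.span ℂ (range fun i => X' i x) := by
    ext v
    rw [(hX x hxU).2 v, (hX' x hxU').2 v, hx]
  have h2 := finrank_span_eq_card (hX x hxU).1
  rwa [h1, finrank_span_eq_card (hX' x hxU').1, Fintype.card_fin, Fintype.card_fin, eq_comm] at h2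

/-- The coincidence locus of two holomorphic foliations by curves is locally the zero set of a
holomorphic map. -/
theorem exists_coincidence_map (hG : IsHolomorphicFoliation G 1)
    (hG' : IsHolomorphicFoliation G' 1) (x : M) :
    ∃ (r : ℝ) (ψ : E → E), 0 < r ∧ Metric.ball (chartAt E x x) r ⊆ (chartAt E x).target ∧
      AnalyticOnNhd ℂ ψ (Metric.ball (chartAt E x x) r) ∧
      ∀ u ∈ Metric.ball (chartAt E x x) r,
        ψ u = 0 ↔ G ((chartAt E x).symm u) = G' ((chartAt E x).symm u) := by
  have : CompleteSpace E := FiniteDimensional.complete ℂ E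
  obtain ⟨U, X, hU, hxU, hX, hXG⟩ := hG.exists_generator x
  obtain ⟨U', X', hU', hxU', hX', hXG'⟩ := hG'.exists_generator x
  set φ := chartAt E x with hφ
  have hx : x ∈ φ.source := mem_chart_source E x
  have hhol : ∀ {Y : VField E M} {u : E}, u ∈ φ.target →
      ContMDiffAt 𝓘(ℂ, E) (𝓘(ℂ, E).prod 𝓘(ℂ, E)) ω
        (fun z => (⟨z, Y z⟩ : TangentBundle 𝓘(ℂ, E) M)) (φ.symm u) →
      AnalyticAt ℂ (inChart x Y) u := fun {Y u} hu hY => by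
    have h1 := (contMDiffAt_iff_inChart (φ.map_target hu)).1 hY
    rw [← hφ, φ.right_inv hu] at h1
    exact h1.analyticAt
  have h0 : inChart x X' (φ x) ≠ 0 := by
    rw [hφ, inChart_apply hx, coord_self]
    obtain ⟨a, ha, ha0, -⟩ := hXG' x hxU'
    rw [ha]
    exact ha0
  obtain ⟨l, hl⟩ := SeparatingDual.exists_ne_zero (R := ℂ) h0
  have hxt : φ x ∈ φ.target := φ.map_source hx
  have hUU : IsOpen (φ.target ∩ φ.symm ⁻¹' (U ∩ U')) := φ.isOpen_inter_preimage_symm (hU.inter hU')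
  have hxs : φ.symm (φ x) = x := φ.left_inv hx
  have hl' : ∀ᶠ u in 𝓝 (φ x), l (inChart x X' u) ≠ 0 := by
    have hc : ContinuousAt (inChart x X') (φ x) :=
      (hhol hxt (by rw [hxs]; exact hX' x hxU')).continuousAt
    exact (l.continuous.continuousAt.comp hc).eventually_ne hl
  have hev : ∀ᶠ u in 𝓝 (φ x), u ∈ φ.target ∩ φ.symm ⁻¹' (U ∩ U') ∧ l (inChart x X' u) ≠ 0 :=
    (Filter.eventually_mem_set.2 (hUU.mem_nhds ⟨hxt, by rw [mem_preimage, hxs]; exact ⟨hxU, hxU'⟩⟩)).and hl'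
  obtain ⟨r, hr, hball⟩ := Metric.eventually_nhds_iff_ball.1 hev
  -- Where `l(X') ≠ 0`, the map `l(X') X - l(X) X'` vanishes exactly when `X` is a complex multiple
  -- of `X'`.
  refine ⟨r, fun u => l (inChart x X' u) • inChart x X u - l (inChart x X u) • inChart x X' u, hr,
    fun u hu => (hball u hu).1.1, fun u hu => ?_, fun u hu => ?_⟩
  · obtain ⟨⟨hut, huU, huU'⟩, -⟩ := hball u hu
    have a1 := hhol hut (hX _ huU)
    have a2 := hhol hut (hX' _ huU')
    exact (((l.analyticAt _).comp a2).smul a1).sub (((l.analyticAt _).comp a1).smul a2)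
  · obtain ⟨⟨hut, huU, huU'⟩, hlu⟩ := hball u hu
    set y := φ.symm u
    have hy : y ∈ φ.source := φ.map_target hut
    obtain ⟨a, ha, ha0, has⟩ := hXG y huU
    obtain ⟨b, hb, -, hbs⟩ := hXG' y huU'
    change l (coord x y (X' y)) • coord x y (X y) - l (coord x y (X y)) • coord x y (X' y) = 0 ↔ _
    change l (coord x y (X' y)) ≠ 0 at hlu
    rw [hb] at hlu
    rw [ha, hb, sub_eq_zero]
    constructor
    · intro h1
      obtain ⟨c, hc⟩ : ∃ c : ℂ, a = c • b := by
        refine ⟨(l (coord x y b))⁻¹ * l (coord x y a), coord_injective hy ?_⟩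
        rw [coord_complex_smul hy, mul_smul, ← h1, smul_smul, inv_mul_cancel₀ hlu, one_smul]
      have hc0 : c ≠ 0 := by
        rintro rfl
        exact ha0 (hc.trans (zero_smul ℂ b))
      ext v
      refine (has v).symm.trans (Iff.trans ?_ (hbs v))
      rw [hc, Submodule.span_singleton_smul_eq hc0.isUnit]
    · intro h1
      have h2 : a ∈ Submodule.span ℂ {b} := by
        refine (hbs a).2 ?_
        rw [← h1]
        refine (has a).1 ?_
        exact Submodule.mem_span_singleton_self _
      obtain ⟨c, hc⟩ := Submodule.mem_span_singleton.1 h2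
      rw [← hc, coord_complex_smul hy, map_smul, smul_smul, smul_eq_mul, mul_comm]

/-- Two holomorphic foliations by curves of a connected manifold that coincide on a nonempty open
set coincide everywhere. -/
theorem eq_of_eventually_eq [PreconnectedSpace M] (hG : IsHolomorphicFoliation G 1)
    (hG' : IsHolomorphicFoliation G' 1) {x : M} (hx : ∀ᶠ y in 𝓝 x, G y = G' y) : G = G' := by
  have hopen : IsOpen {z : M | ∀ᶠ y in 𝓝 z, G y = G' y} := isOpen_setOfPred_eventually_nhds
  have hclosed : IsClosed {z : M | ∀ᶠ y in 𝓝 z, G y = G' y} := by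
    rw [← closure_subset_iff_isClosed]
    intro z hz
    -- At a limit point `z`, `ψ` vanishes near some point of a ball centred at `z`, hence on the
    -- whole ball by the identity theorem.
    obtain ⟨r, ψ, hr, hrt, hψ, hψ0⟩ := hG.exists_coincidence_map hG' z
    set φ := chartAt E z with hφ
    have hzs : z ∈ φ.source := mem_chart_source E z
    set N := φ.source ∩ φ ⁻¹' Metric.ball (φ z) r
    have hN : IsOpen N := φ.isOpen_inter_preimage Metric.isOpen_ball
    have hzN : z ∈ N := ⟨hzs, Metric.mem_ball_self hr⟩
    obtain ⟨y, hyN, hy⟩ := mem_closure_iff.1 hz N hN hzN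
    have h1 : ψ =ᶠ[𝓝 (φ y)] 0 := by
      have hc : Filter.Tendsto φ.symm (𝓝 (φ y)) (𝓝 y) := by
        have := φ.symm.continuousAt (x := φ y) (φ.map_source hyN.1)
        rwa [ContinuousAt, φ.left_inv hyN.1] at this
      filter_upwards [hc.eventually hy, Metric.isOpen_ball.mem_nhds hyN.2] with u hu hub
      exact (hψ0 u hub).2 hu
    have h2 := hψ.eqOn_zero_of_preconnected_of_eventuallyEq_zero
      (convex_ball (φ z) r).isPreconnected hyN.2 h1
    refine Filter.mem_of_superset (hN.mem_nhds hzN) fun w hw => ?_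
    have h3 := (hψ0 _ hw.2).1 (h2 hw.2)
    rwa [φ.left_inv hw.1] at h3
  have huniv := IsClopen.eq_univ ⟨hclosed, hopen⟩ ⟨x, hx⟩
  funext y
  have hy : y ∈ {z : M | ∀ᶠ y in 𝓝 z, G y = G' y} := huniv ▸ mem_univ y
  exact hy.self_of_nhds

end IsHolomorphicFoliation

namespace IsLightlikeParallelLCK

variable {g : BilinField E M} {ν : ℕ} (h : IsLightlikeParallelLCK g ν)

include h

/-- A holomorphic foliation of a connected manifold that is tangent to the second canonical
foliation along a leaf of the first one is the second canonical foliation. -/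
theorem eq_secondFoliation_of_leaf [PreconnectedSpace M] {G : Distribution E M} {k : ℕ}
    (hG : IsHolomorphicFoliation G k) {x : M}
    (hL : ∀ y ∈ leaf (firstFoliation g) x, G y = secondFoliation g y) : G = secondFoliation g := by
  have : CompleteSpace E := FiniteDimensional.complete ℂ E
  have hP := h.isHolomorphicFoliation_second
  -- Agreement at the single point `x` already forces rank one.
  obtain rfl := hG.rank_eq hP (hL x (Relation.EqvGen.refl _))
  obtain ⟨r, ψ, hr, hrt, hψ, hψ0⟩ := hG.exists_coincidence_map hP x
  have hx := mem_chart_source E x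
  have h1 := h.eventually_eq_zero_of_leaf hx Metric.isOpen_ball (Metric.mem_ball_self hr) hψ
    fun u hu _ hul => (hψ0 u hu).2 (hL _ hul)
  refine hG.eq_of_eventually_eq hP (x := x) ?_
  have hc : ContinuousAt (chartAt E x) x := (chartAt E x).continuousAt hx
  filter_upwards [hc.eventually h1, hc.eventually (Metric.ball_mem_nhds _ hr),
    (chartAt E x).open_source.mem_nhds hx] with y hy hyb hys
  have h2 := (hψ0 _ hyb).1 hy
  rwa [(chartAt E x).left_inv hys] at h2

end IsLightlikeParallelLCK

end IndefLCK
open IndefLCK in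
theorem proposition4 {E : Type*} [NormedAddCommGroup E] [NormedSpace ℂ E] [FiniteDimensional ℂ E]
    {M : Type*} [TopologicalSpace M] [T2Space M] [ChartedSpace E M] [IsManifold 𝓘(ℂ, E) ω M]
    (n s : ℕ) (hn : Module.finrank ℂ E = n) (hs : 0 < s) (hsn : s < n)
    (g : BilinField E M) (hg : IsIndefHermitian g (2 * s)) (hlck : IsLCK g)
    (hparallel : IsParallelForm g (leeForm g)) (hlight : IsLightlike g (leeField g)) :
    (∀ L ∈ leaves (firstFoliation g),
      IsLeviDegenerate (firstFoliation g) L ∧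
      ∀ x ∈ L, leeZ g x ≠ 0 ∧ leeZ g x ∈ leviNull (firstFoliation g) x ∧
        leeZ g x ∈ leviRadical (firstFoliation g) x) ∧
    IsSubfoliation (secondFoliation g) (firstFoliation g) ∧
    (n = 2 →
      (∀ L ∈ leaves (firstFoliation g), IsLeviFlat (firstFoliation g) L) ∧
      IsHolomorphicFoliation (secondFoliation g) 1 ∧
      (∀ L ∈ leaves (firstFoliation g),
        ExtendsLeviFoliation (secondFoliation g) (firstFoliation g) L) ∧
      (∀ G : Distribution E M, (∃ k, IsHolomorphicFoliation G k) →
        (∀ L ∈ leaves (firstFoliation g), ExtendsLeviFoliation G (firstFoliation g) L) →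
          G = secondFoliation g) ∧
      (PreconnectedSpace M → ∀ L ∈ leaves (firstFoliation g), ∀ G : Distribution E M,
        (∃ k, IsHolomorphicFoliation G k) → ExtendsLeviFoliation G (firstFoliation g) L →
          G = secondFoliation g)) := by
  -- The bounds `0 < s < n` give `n ≥ 2`.
  have h : IsLightlikeParallelLCK g (2 * s) := ⟨by omega, hg, hlck, hparallel, hlight⟩
  have hrad : ∀ x : M, leeZ g x ∈ leviRadical (firstFoliation g) x := fun x =>
    ⟨h.leeZ_mem_T10 x, fun V W hV hW _ => h.leviForm_eq_zero hV hW⟩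
  refine ⟨fun L _ => ⟨fun x _ => ⟨_, hrad x, h.leeZ_ne_zero x⟩, fun x _ => ⟨h.leeZ_ne_zero x,
    ⟨h.leeZ_mem_T10 x, fun V hV _ => h.leviForm_eq_zero hV hV⟩, hrad x⟩⟩, h.isSubfoliation, ?_⟩
  intro hn2
  have hP := h.secondFoliation_eq_leviDist (hn.trans hn2)
  refine ⟨fun L _ x _ V W hV hW => h.leviForm_eq_zero hV hW, h.isHolomorphicFoliation_second,
    fun L _ x _ => hP x, fun G _ hG => funext fun x => ?_, ?_⟩
  -- Every point lies on its own leaf, so the tangent space there is prescribed.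
  · rw [hG _ ⟨x, rfl⟩ x (Relation.EqvGen.refl _), hP]
  · rintro hM _ ⟨x, rfl⟩ G ⟨k, hG⟩ hL
    exact h.eq_secondFoliation_of_leaf hG fun y hy => (hL y hy).trans (hP y).symm
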